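/- Let $K$ be a field of characteristic $0$ and $n\ge 0$. A (non-unital) Poisson algebra over $K$ is a $K$-vector space with a commutative associative bilinear product $\cdot$ and a Lie bracket $[\,,]$ such that $[a,b\cdot c]=[a,b]\cdot c+b\cdot[a,c]$; it is metabelian if every product and every bracket of two elements, each of which is itself a product or a bracket, is zero. Let $P_{2n}$ be the free metabelian Poisson algebra over $K$ on the generators $z_1<\dots<z_{2n}$, where $z_i=x_i$ and $z_{n+i}=y_i$ for $1\le i\le n$. Let $\delta$ be the derivation of $P_{2n}$ (for both operations) with $\delta(y_i)=x_i$, $\delta(x_i)=0$. Write $[a,b,c]=[[a,b],c]$, and let $K\mathcal B_4$ be the span of all $[z_i,z_j,z_k]\cdot z_l$ with $1\le j<i\le l\le 2n$ and $j\le k<l$. **Theorem.** The vector space $(K\mathcal B_4)^\delta=\{p\in K\mathcal B_4:\delta(p)=0\}$ has as a basis the following elements, with all indices in $\{1,\dots,n\}$ (elements with different labels are different). 1. $[x_i,x_j,x_k]\cdot x_l$ for $j<i\le l$, $j\le k<l$. 2. $[y_i,x_i,x_i]\cdot y_i$ for all $i$. 3. For $j<i$: $[x_i,x_j,x_j]\cdot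 y_j$; $[x_i,x_j,x_i]\cdot y_i$; $[x_i,x_j,x_i]\cdot y_j+[x_i,x_j,x_j]\cdot y_i$; $[y_j,x_j,x_i]\cdot y_i$; $[y_j,x_i,x_i]\cdot y_i+[y_i,x_j,x_i]\cdot y_i$; $[y_j,x_j,x_i]\cdot y_j+[y_j,x_j,x_j]\cdot y_i$; $[y_j,x_i,x_i]\cdot y_j-2[x_i,x_j,y_j]\cdot y_i+[y_i,x_j,x_j]\cdot y_i$. 4. For $j<i<k$: $[x_i,x_j,x_k]\cdot y_k$; $[x_k,x_j,x_i]\cdot y_i$; $[x_i,x_j,x_i]\cdot y_k+[x_i,x_j,x_k]\cdot y_i$; $[x_i,x_j,x_i]\cdot y_k+[x_k,x_i,x_i]\cdot y_j$; $[x_i,x_j,x_k]\cdot y_j-[x_k,x_j,x_i]\cdot y_j$; $[x_i,x_j,x_k]\cdot y_j+[x_i,x_j,x_j]\cdot y_k$; $[x_i,x_j,x_k]\cdot y_j+[x_k,x_j,x_j]\cdot y_i$; $[x_k,x_j,x_k]\cdot y_i+[x_k,x_j,x_i]\cdot y_k$; $[x_k,x_j,x_k]\cdot y_i-[x_k,x_i,x_k]\cdot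 y_j$; $[y_i,x_j,x_k]\cdot y_i+[x_i,x_j,y_i]\cdot y_k+[x_k,x_i,y_j]\cdot y_i+[y_j,x_i,x_i]\cdot y_k$; $[y_j,x_i,x_k]\cdot y_i-[x_i,x_j,y_i]\cdot y_k-[x_k,x_i,y_j]\cdot y_i+[y_i,x_j,x_i]\cdot y_k$; $[x_k,x_j,y_i]\cdot y_k+[x_k,x_i,y_j]\cdot y_k-[y_j,x_k,x_k]\cdot y_i-[y_k,x_j,x_i]\cdot y_k$; $[y_i,x_j,x_k]\cdot y_k+[y_j,x_i,x_k]\cdot y_k$; $[y_j,x_j,x_k]\cdot y_i+[y_j,x_j,x_i]\cdot y_k$; $[x_i,x_j,y_j]\cdot y_k+[x_k,x_j,y_j]\cdot y_i-[y_i,x_j,x_j]\cdot y_k-[y_j,x_i,x_k]\cdot y_j$. 5. For $j<i<k<l$: $[x_k,x_j,x_l]\cdot y_i+[x_i,x_j,x_k]\cdot y_l-[x_k,x_i,x_l]\cdot y_j$; $[x_k,x_j,x_i]\cdot y_l-[x_i,x_j,x_k]\cdot y_l+[x_k,x_i,x_l]\cdot y_j$; $[x_l,x_i,x_k]\cdot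 y_j+[x_i,x_j,x_k]\cdot y_l-[x_k,x_i,x_l]\cdot y_j$; $[x_i,x_j,x_l]\cdot y_k+[x_i,x_j,x_k]\cdot y_l$; $[x_l,x_j,x_i]\cdot y_k+[x_k,x_i,x_l]\cdot y_j$; $[x_l,x_j,x_k]\cdot y_i-[x_k,x_i,x_l]\cdot y_j$; $[x_l,x_k,y_j]\cdot y_i+[x_i,x_j,y_k]\cdot y_l+[y_j,x_i,x_k]\cdot y_l+[y_i,x_j,x_l]\cdot y_k$; $[y_j,x_k,x_l]\cdot y_i+[y_k,x_j,x_i]\cdot y_l-[x_l,x_i,y_j]\cdot y_k-[x_k,x_j,y_i]\cdot y_l$; $[y_j,x_i,x_l]\cdot y_k+[y_i,x_j,x_k]\cdot y_l+[y_j,x_i,x_k]\cdot y_l+[y_i,x_j,x_l]\cdot y_k$; $[x_l,x_j,y_i]\cdot y_k+[x_k,x_i,y_j]\cdot y_l-[y_j,x_i,x_k]\cdot y_l-[y_i,x_j,x_l]\cdot y_k-[x_l,x_i,y_j]\cdot y_k-[x_k,x_j,y_i]\cdot y_l$. Moreover, neither the span of all $[y_i,y_j,y_k]\cdot y_l$ nor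 the span of all $[y_i,x_j,y_k]\cdot y_l$ contains a nonzero element $p$ with $\delta(p)=0$. -/

import Mathlib

/-- Formal expressions in generators `X` with the operations of a (non-unital) Poisson algebra
over `K`: addition, scalar multiplication, commutative product and Lie bracket. -/
inductive PoissonExpr (K : Type*) (X : Type*) where
  | of : X → PoissonExpr K X
  | zero : PoissonExpr K X
  | add : PoissonExpr K X → PoissonExpr K X → PoissonExpr K X
  | smul : K → PoissonExpr K X → PoissonExpr K X
  | mul : PoissonExpr K X → PoissonExpr K X → PoissonExpr K X
  | br : PoissonExpr K X → PoissonExpr K X → PoissonExpr K X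

namespace PoissonExpr

instance (K X : Type*) : Zero (PoissonExpr K X) := ⟨zero⟩
instance (K X : Type*) : Add (PoissonExpr K X) := ⟨add⟩
instance (K X : Type*) : SMul K (PoissonExpr K X) := ⟨smul⟩
instance (K X : Type*) : Mul (PoissonExpr K X) := ⟨mul⟩
instance (K X : Type*) : Bracket (PoissonExpr K X) (PoissonExpr K X) := ⟨br⟩

/-- The identities of metabelian Poisson algebras: congruence rules, the laws of a `K`-module,
of a commutative associative (non-unital) `K`-algebra, of a Lie algebra over `K`, the Leibniz
rule, and the vanishing of all products and brackets of two elements each of which is a product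
or a bracket. -/
inductive Rel (K : Type*) [Field K] (X : Type*) : PoissonExpr K X → PoissonExpr K X → Prop
  -- congruence
  | add_left (a b c : PoissonExpr K X) : Rel K X a b → Rel K X (a + c) (b + c)
  | add_right (a b c : PoissonExpr K X) : Rel K X a b → Rel K X (c + a) (c + b)
  | smul_congr (r : K) (a b : PoissonExpr K X) : Rel K X a b → Rel K X (r • a) (r • b)
  | mul_left (a b c : PoissonExpr K X) : Rel K X a b → Rel K X (a * c) (b * c)
  | mul_right (a b c : PoissonExpr K X) : Rel K X a b → Rel K X (c * a) (c * b)
  | br_left (a b c : PoissonExpr K X) : Rel K X a b → Rel K X ⁅a, c⁆ ⁅b, c⁆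
  | br_right (a b c : PoissonExpr K X) : Rel K X a b → Rel K X ⁅c, a⁆ ⁅c, b⁆
  -- module over `K`
  | add_comm (a b : PoissonExpr K X) : Rel K X (a + b) (b + a)
  | add_assoc (a b c : PoissonExpr K X) : Rel K X (a + b + c) (a + (b + c))
  | zero_add (a : PoissonExpr K X) : Rel K X (0 + a) a
  | one_smul (a : PoissonExpr K X) : Rel K X ((1 : K) • a) a
  | mul_smul (r s : K) (a : PoissonExpr K X) : Rel K X ((r * s) • a) (r • s • a)
  | smul_add (r : K) (a b : PoissonExpr K X) : Rel K X (r • (a + b)) (r • a + r • b)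
  | add_smul (r s : K) (a : PoissonExpr K X) : Rel K X ((r + s) • a) (r • a + s • a)
  | zero_smul (a : PoissonExpr K X) : Rel K X ((0 : K) • a) 0
  -- commutative associative algebra
  | mul_comm (a b : PoissonExpr K X) : Rel K X (a * b) (b * a)
  | mul_assoc (a b c : PoissonExpr K X) : Rel K X (a * b * c) (a * (b * c))
  | add_mul (a b c : PoissonExpr K X) : Rel K X ((a + b) * c) (a * c + b * c)
  | smul_mul (r : K) (a b : PoissonExpr K X) : Rel K X ((r • a) * b) (r • (a * b))
  -- Lie algebra
  | add_br (a b c : PoissonExpr K X) : Rel K X ⁅a + b, c⁆ (⁅a, c⁆ + ⁅b, c⁆)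
  | br_add (a b c : PoissonExpr K X) : Rel K X ⁅a, b + c⁆ (⁅a, b⁆ + ⁅a, c⁆)
  | smul_br (r : K) (a b : PoissonExpr K X) : Rel K X ⁅r • a, b⁆ (r • ⁅a, b⁆)
  | br_smul (r : K) (a b : PoissonExpr K X) : Rel K X ⁅a, r • b⁆ (r • ⁅a, b⁆)
  | br_self (a : PoissonExpr K X) : Rel K X ⁅a, a⁆ 0
  | jacobi (a b c : PoissonExpr K X) :
      Rel K X (⁅⁅a, b⁆, c⁆ + ⁅⁅b, c⁆, a⁆ + ⁅⁅c, a⁆, b⁆) 0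
  -- Poisson algebra
  | leibniz (a b c : PoissonExpr K X) : Rel K X ⁅a, b * c⁆ (⁅a, b⁆ * c + b * ⁅a, c⁆)
  -- metabelian
  | mul_mul_mul (a b c d : PoissonExpr K X) : Rel K X ((a * b) * (c * d)) 0
  | br_mul_mul (a b c d : PoissonExpr K X) : Rel K X (⁅a, b⁆ * (c * d)) 0
  | br_mul_br (a b c d : PoissonExpr K X) : Rel K X (⁅a, b⁆ * ⁅c, d⁆) 0
  | mul_br_mul (a b c d : PoissonExpr K X) : Rel K X ⁅a * b, c * d⁆ 0
  | br_br_mul (a b c d : PoissonExpr K X) : Rel K X ⁅⁅a, b⁆, c * d⁆ 0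
  | br_br_br (a b c d : PoissonExpr K X) : Rel K X ⁅⁅a, b⁆, ⁅c, d⁆⁆ 0

end PoissonExpr

/-- The free metabelian Poisson algebra over `K` on the generators `X`. -/
def FreeMetabelianPoisson (K : Type*) [Field K] (X : Type*) : Type _ :=
  Quot (PoissonExpr.Rel K X)

namespace FreeMetabelianPoisson

section Algebra

variable {K : Type*} [Field K] {X : Type*}

/-- The class of an expression. -/
def mk (a : PoissonExpr K X) : FreeMetabelianPoisson K X := Quot.mk _ a

/-- The generators. -/
def of (K : Type*) [Field K] {X : Type*} (z : X) : FreeMetabelianPoisson K X :=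
  mk (PoissonExpr.of z)

theorem mk_eq {a b : PoissonExpr K X} (h : PoissonExpr.Rel K X a b) : mk a = mk b :=
  Quot.sound h

instance : Zero (FreeMetabelianPoisson K X) := ⟨mk 0⟩

instance : Add (FreeMetabelianPoisson K X) :=
  ⟨Quot.map₂ (fun a b => a + b) (fun _ _ _ h => .add_right _ _ _ h)
    (fun _ _ _ h => .add_left _ _ _ h)⟩

instance : SMul K (FreeMetabelianPoisson K X) :=
  ⟨fun r => Quot.map (fun a => r • a) (fun _ _ h => .smul_congr _ _ _ h)⟩

instance : Mul (FreeMetabelianPoisson K X) :=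
  ⟨Quot.map₂ (fun a b => a * b) (fun _ _ _ h => .mul_right _ _ _ h)
    (fun _ _ _ h => .mul_left _ _ _ h)⟩

instance : Bracket (FreeMetabelianPoisson K X) (FreeMetabelianPoisson K X) :=
  ⟨Quot.map₂ (fun a b => ⁅a, b⁆) (fun _ _ _ h => .br_right _ _ _ h)
    (fun _ _ _ h => .br_left _ _ _ h)⟩

theorem zero_smul_eq (a : FreeMetabelianPoisson K X) : (0 : K) • a = 0 :=
  Quot.inductionOn a (fun a => mk_eq (.zero_smul a))

theorem one_smul_eq (a : FreeMetabelianPoisson K X) : (1 : K) • a = a :=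
  Quot.inductionOn a (fun a => mk_eq (.one_smul a))

theorem add_smul_eq (r s : K) (a : FreeMetabelianPoisson K X) :
    (r + s) • a = r • a + s • a :=
  Quot.inductionOn a (fun a => mk_eq (.add_smul r s a))

theorem add_comm_eq (a b : FreeMetabelianPoisson K X) : a + b = b + a :=
  Quot.induction_on₂ a b (fun a b => mk_eq (.add_comm a b))

theorem zero_add_eq (a : FreeMetabelianPoisson K X) : 0 + a = a :=
  Quot.inductionOn a (fun a => mk_eq (.zero_add a))

instance : Neg (FreeMetabelianPoisson K X) := ⟨fun a => (-1 : K) • a⟩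

instance : AddCommGroup (FreeMetabelianPoisson K X) where
  add_assoc a b c := Quot.induction_on₃ a b c (fun a b c => mk_eq (.add_assoc a b c))
  zero_add := zero_add_eq
  add_zero a := by rw [add_comm_eq, zero_add_eq]
  nsmul := nsmulRec
  zsmul := zsmulRec
  neg_add_cancel a := by
    change (-1 : K) • a + a = 0
    have h := add_smul_eq (-1 : K) 1 a
    rw [neg_add_cancel, zero_smul_eq, one_smul_eq] at h
    exact h.symm
  add_comm := add_comm_eq

instance : Module K (FreeMetabelianPoisson K X) where
  one_smul := one_smul_eq
  mul_smul r s a := Quot.inductionOn a (fun a => mk_eq (.mul_smul r s a))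
  smul_add r a b := Quot.induction_on₂ a b (fun a b => mk_eq (.smul_add r a b))
  add_smul := add_smul_eq
  zero_smul := zero_smul_eq
  smul_zero r := by
    have h : (r * 0) • (0 : FreeMetabelianPoisson K X) = r • (0 : K) • 0 :=
      mk_eq (.mul_smul r 0 0)
    rw [mul_zero, zero_smul_eq] at h
    exact h.symm

/-! The laws of a metabelian Poisson algebra. -/

theorem mul_comm' (a b : FreeMetabelianPoisson K X) : a * b = b * a :=
  Quot.induction_on₂ a b (fun a b => mk_eq (.mul_comm a b))

theorem mul_assoc' (a b c : FreeMetabelianPoisson K X) : a * b * c = a * (b * c) :=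
  Quot.induction_on₃ a b c (fun a b c => mk_eq (.mul_assoc a b c))

theorem add_mul' (a b c : FreeMetabelianPoisson K X) : (a + b) * c = a * c + b * c :=
  Quot.induction_on₃ a b c (fun a b c => mk_eq (.add_mul a b c))

theorem mul_add' (a b c : FreeMetabelianPoisson K X) : c * (a + b) = c * a + c * b := by
  rw [mul_comm', add_mul', mul_comm' a, mul_comm' b]

theorem smul_mul' (r : K) (a b : FreeMetabelianPoisson K X) : (r • a) * b = r • (a * b) :=
  Quot.induction_on₂ a b (fun a b => mk_eq (.smul_mul r a b))

theorem add_br' (a b c : FreeMetabelianPoisson K X) : ⁅a + b, c⁆ = ⁅a, c⁆ + ⁅b, c⁆ :=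
  Quot.induction_on₃ a b c (fun a b c => mk_eq (.add_br a b c))

theorem br_add' (a b c : FreeMetabelianPoisson K X) : ⁅a, b + c⁆ = ⁅a, b⁆ + ⁅a, c⁆ :=
  Quot.induction_on₃ a b c (fun a b c => mk_eq (.br_add a b c))

theorem smul_br' (r : K) (a b : FreeMetabelianPoisson K X) : ⁅r • a, b⁆ = r • ⁅a, b⁆ :=
  Quot.induction_on₂ a b (fun a b => mk_eq (.smul_br r a b))

theorem br_smul' (r : K) (a b : FreeMetabelianPoisson K X) : ⁅a, r • b⁆ = r • ⁅a, b⁆ :=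
  Quot.induction_on₂ a b (fun a b => mk_eq (.br_smul r a b))

theorem br_self' (a : FreeMetabelianPoisson K X) : ⁅a, a⁆ = 0 :=
  Quot.inductionOn a (fun a => mk_eq (.br_self a))

theorem br_add_br_swap (a b : FreeMetabelianPoisson K X) : ⁅a, b⁆ + ⁅b, a⁆ = 0 := by
  have h := br_self' (a + b)
  rw [add_br', br_add', br_add', br_self', br_self'] at h
  simpa using h

theorem jacobi' (a b c : FreeMetabelianPoisson K X) :
    ⁅⁅a, b⁆, c⁆ + ⁅⁅b, c⁆, a⁆ + ⁅⁅c, a⁆, b⁆ = 0 :=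
  Quot.induction_on₃ a b c (fun a b c => mk_eq (.jacobi a b c))

theorem leibniz' (a b c : FreeMetabelianPoisson K X) :
    ⁅a, b * c⁆ = ⁅a, b⁆ * c + b * ⁅a, c⁆ :=
  Quot.induction_on₃ a b c (fun a b c => mk_eq (.leibniz a b c))

theorem mul_mul_mul' (a b c d : FreeMetabelianPoisson K X) : (a * b) * (c * d) = 0 :=
  Quot.induction_on₂ a b (fun a b =>
    Quot.induction_on₂ c d (fun c d => mk_eq (.mul_mul_mul a b c d)))

theorem br_mul_mul' (a b c d : FreeMetabelianPoisson K X) : ⁅a, b⁆ * (c * d) = 0 :=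
  Quot.induction_on₂ a b (fun a b =>
    Quot.induction_on₂ c d (fun c d => mk_eq (.br_mul_mul a b c d)))

theorem br_mul_br' (a b c d : FreeMetabelianPoisson K X) : ⁅a, b⁆ * ⁅c, d⁆ = 0 :=
  Quot.induction_on₂ a b (fun a b =>
    Quot.induction_on₂ c d (fun c d => mk_eq (.br_mul_br a b c d)))

theorem mul_br_mul' (a b c d : FreeMetabelianPoisson K X) : ⁅a * b, c * d⁆ = 0 :=
  Quot.induction_on₂ a b (fun a b =>
    Quot.induction_on₂ c d (fun c d => mk_eq (.mul_br_mul a b c d)))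

theorem br_br_mul' (a b c d : FreeMetabelianPoisson K X) : ⁅⁅a, b⁆, c * d⁆ = 0 :=
  Quot.induction_on₂ a b (fun a b =>
    Quot.induction_on₂ c d (fun c d => mk_eq (.br_br_mul a b c d)))

theorem br_br_br' (a b c d : FreeMetabelianPoisson K X) : ⁅⁅a, b⁆, ⁅c, d⁆⁆ = 0 :=
  Quot.induction_on₂ a b (fun a b =>
    Quot.induction_on₂ c d (fun c d => mk_eq (.br_br_br a b c d)))

/-- The derivation extending `f : X → FreeMetabelianPoisson K X`, on expressions. -/
def derAux (f : X → FreeMetabelianPoisson K X) : PoissonExpr K X → FreeMetabelianPoisson K X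
  | .of z => f z
  | .zero => 0
  | .add a b => derAux f a + derAux f b
  | .smul r a => r • derAux f a
  | .mul a b => derAux f a * mk b + mk a * derAux f b
  | .br a b => ⁅derAux f a, mk b⁆ + ⁅mk a, derAux f b⁆

theorem derAux_rel (f : X → FreeMetabelianPoisson K X) {a b : PoissonExpr K X}
    (h : PoissonExpr.Rel K X a b) : derAux f a = derAux f b := by
  have hz : derAux f (0 : PoissonExpr K X) = 0 := rfl
  have ha (a b : PoissonExpr K X) : derAux f (a + b) = derAux f a + derAux f b := rfl
  have hs (r : K) (a : PoissonExpr K X) : derAux f (r • a) = r • derAux f a := rfl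
  have hm (a b : PoissonExpr K X) :
    derAux f (a * b) = derAux f a * mk b + mk a * derAux f b := rfl
  have hb (a b : PoissonExpr K X) :
    derAux f ⁅a, b⁆ = ⁅derAux f a, mk b⁆ + ⁅mk a, derAux f b⁆ := rfl
  have ma (a b : PoissonExpr K X) : mk (a + b) = mk a + mk b := rfl
  have ms (r : K) (a : PoissonExpr K X) : mk (r • a) = r • mk a := rfl
  have mm (a b : PoissonExpr K X) : mk (a * b) = mk a * mk b := rfl
  have mb (a b : PoissonExpr K X) : mk ⁅a, b⁆ = ⁅mk a, mk b⁆ := rfl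
  induction h with
  | add_left a b c h ih => rw [ha, ha, ih]
  | add_right a b c h ih => rw [ha, ha, ih]
  | smul_congr r a b h ih => rw [hs, hs, ih]
  | mul_left a b c h ih => rw [hm, hm, ih, mk_eq h]
  | mul_right a b c h ih => rw [hm, hm, ih, mk_eq h]
  | br_left a b c h ih => rw [hb, hb, ih, mk_eq h]
  | br_right a b c h ih => rw [hb, hb, ih, mk_eq h]
  | br_self a => rw [hb, hz, br_add_br_swap]
  | jacobi a b c =>
    simp only [ha, hb, mb, hz, add_br']
    have h1 := jacobi' (derAux f a) (mk b) (mk c)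
    have h2 := jacobi' (mk a) (derAux f b) (mk c)
    have h3 := jacobi' (mk a) (mk b) (derAux f c)
    have h := congrArg₂ (· + ·) (congrArg₂ (· + ·) h1 h2) h3
    simp only [add_zero] at h
    rw [← h]; abel
  | leibniz a b c =>
    simp only [ha, hb, hm, mb, mm, br_add', add_mul', mul_add', leibniz']
    abel
  | mul_comm a b => rw [hm, hm, mul_comm' (derAux f b), mul_comm' (mk b), add_comm]
  | mul_assoc a b c =>
    simp only [hm, mm, add_mul', mul_add', mul_assoc']
    abel
  | _ =>
    simp only [ha, hb, hm, hs, hz, ma, ms, mm, mb, add_mul', mul_add', add_br', br_add',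
      smul_mul', smul_br', br_smul', mul_mul_mul', br_mul_mul', br_mul_br', mul_br_mul', br_br_mul', br_br_br', mul_smul,
      smul_add, add_smul, zero_smul, one_smul, zero_add, add_zero]
    try abel

/-- The derivation (for the product and for the bracket) of the free metabelian Poisson algebra
that takes the values `f` on the generators. -/
def der (f : X → FreeMetabelianPoisson K X) :
    FreeMetabelianPoisson K X →ₗ[K] FreeMetabelianPoisson K X where
  toFun := Quot.lift (derAux f) (fun _ _ h => derAux_rel f h)
  map_add' a b := Quot.induction_on₂ a b (fun _ _ => rfl)
  map_smul' _ a := Quot.inductionOn a (fun _ => rfl)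

theorem der_of (f : X → FreeMetabelianPoisson K X) (z : X) : der f (of K z) = f z := rfl

theorem der_mul (f : X → FreeMetabelianPoisson K X) (a b : FreeMetabelianPoisson K X) :
    der f (a * b) = der f a * b + a * der f b :=
  Quot.induction_on₂ a b (fun _ _ => rfl)

theorem der_br (f : X → FreeMetabelianPoisson K X) (a b : FreeMetabelianPoisson K X) :
    der f ⁅a, b⁆ = ⁅der f a, b⁆ + ⁅a, der f b⁆ :=
  Quot.induction_on₂ a b (fun _ _ => rfl)

end Algebra

section Rank

variable (K : Type*) [Field K] (n : ℕ)

/-- The free metabelian Poisson algebra of rank `2 n`, with generators `z 0 < ⋯ < z (2 n - 1)`. -/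
abbrev P : Type _ := FreeMetabelianPoisson K (Fin (n + n))

variable {n}

/-- The first `n` generators `x 0 < ⋯ < x (n - 1)`. -/
def x (i : Fin n) : P K n := of K (Fin.castAdd n i)

/-- The last `n` generators `y 0 < ⋯ < y (n - 1)`. -/
def y (i : Fin n) : P K n := of K (Fin.natAdd n i)

variable (n)

/-- The derivation with `x i ↦ 0` and `y i ↦ x i`. -/
def delta : P K n →ₗ[K] P K n :=
  der (Fin.addCases (fun _ : Fin n => 0) (fun i : Fin n => x K i))

variable {K n}

/-- The element `[a, b, c] · d`, where `[a, b, c] = [[a, b], c]`. -/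
def q (a b c d : P K n) : P K n := ⁅⁅a, b⁆, c⁆ * d

variable (K n)

/-- The set of all `[z i, z j, z k] · z l` with `j < i ≤ l` and `j ≤ k < l`. -/
def setB4 : Set (P K n) :=
  {p | ∃ i j k l : Fin (n + n), j < i ∧ i ≤ l ∧ j ≤ k ∧ k < l ∧
    p = q (of K i) (of K j) (of K k) (of K l)}

/-- The constants of `delta` in the span of `setB4`. -/
def constantsB4 : Submodule K (P K n) :=
  Submodule.span K (setB4 K n) ⊓ LinearMap.ker (delta K n)

/-- The span of all `[y i, y j, y k] · y l`. -/
def spanYYYY : Submodule K (P K n) :=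
  Submodule.span K {p | ∃ i j k l : Fin n, p = q (y K i) (y K j) (y K k) (y K l)}

/-- The span of all `[y i, x j, y k] · y l`. -/
def spanYXYY : Submodule K (P K n) :=
  Submodule.span K {p | ∃ i j k l : Fin n, p = q (y K i) (x K j) (y K k) (y K l)}

/-- Labels of the elements of the basis. -/
inductive Label (n : ℕ) : Type
  /-- one element for each `(i, j, k, l)` with `j < i ≤ l` and `j ≤ k < l` -/
  | xxxx (i j k l : Fin n) : j < i → i ≤ l → j ≤ k → k < l → Label n
  /-- one element for each `i` -/
  | one (i : Fin n) : Label n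
  /-- seven elements for each `j < i` -/
  | two (j i : Fin n) : j < i → Fin 7 → Label n
  /-- fifteen elements for each `j < i < k` -/
  | three (j i k : Fin n) : j < i → i < k → Fin 15 → Label n
  /-- ten elements for each `j < i < k < l` -/
  | four (j i k l : Fin n) : j < i → i < k → k < l → Fin 10 → Label n

variable {n}

/-- The elements of the basis for `j < i`. -/
def basisTwo (j i : Fin n) : Fin 7 → P K n :=
  let x := x (n := n) K
  let y := y (n := n) K
  ![q (x i) (x j) (x j) (y j),
    q (x i) (x j) (x i) (y i),
    q (x i) (x j) (x i) (y j) + q (x i) (x j) (x j) (y i),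
    q (y j) (x j) (x i) (y i),
    q (y j) (x i) (x i) (y i) + q (y i) (x j) (x i) (y i),
    q (y j) (x j) (x i) (y j) + q (y j) (x j) (x j) (y i),
    q (y j) (x i) (x i) (y j) - (2 : K) • q (x i) (x j) (y j) (y i) + q (y i) (x j) (x j) (y i)]

/-- The elements of the basis for `j < i < k`. -/
def basisThree (j i k : Fin n) : Fin 15 → P K n :=
  let x := x (n := n) K
  let y := y (n := n) K
  ![q (x i) (x j) (x k) (y k),
    q (x k) (x j) (x i) (y i),
    q (x i) (x j) (x i) (y k) + q (x i) (x j) (x k) (y i),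
    q (x i) (x j) (x i) (y k) + q (x k) (x i) (x i) (y j),
    q (x i) (x j) (x k) (y j) - q (x k) (x j) (x i) (y j),
    q (x i) (x j) (x k) (y j) + q (x i) (x j) (x j) (y k),
    q (x i) (x j) (x k) (y j) + q (x k) (x j) (x j) (y i),
    q (x k) (x j) (x k) (y i) + q (x k) (x j) (x i) (y k),
    q (x k) (x j) (x k) (y i) - q (x k) (x i) (x k) (y j),
    q (y i) (x j) (x k) (y i) + q (x i) (x j) (y i) (y k)
      + q (x k) (x i) (y j) (y i) + q (y j) (x i) (x i) (y k),
    q (y j) (x i) (x k) (y i) - q (x i) (x j) (y i) (y k)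
      - q (x k) (x i) (y j) (y i) + q (y i) (x j) (x i) (y k),
    q (x k) (x j) (y i) (y k) + q (x k) (x i) (y j) (y k)
      - q (y j) (x k) (x k) (y i) - q (y k) (x j) (x i) (y k),
    q (y i) (x j) (x k) (y k) + q (y j) (x i) (x k) (y k),
    q (y j) (x j) (x k) (y i) + q (y j) (x j) (x i) (y k),
    q (x i) (x j) (y j) (y k) + q (x k) (x j) (y j) (y i)
      - q (y i) (x j) (x j) (y k) - q (y j) (x i) (x k) (y j)]

/-- The elements of the basis for `j < i < k < l`. -/
def basisFour (j i k l : Fin n) : Fin 10 → P K n :=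
  let x := x (n := n) K
  let y := y (n := n) K
  ![q (x k) (x j) (x l) (y i) + q (x i) (x j) (x k) (y l) - q (x k) (x i) (x l) (y j),
    q (x k) (x j) (x i) (y l) - q (x i) (x j) (x k) (y l) + q (x k) (x i) (x l) (y j),
    q (x l) (x i) (x k) (y j) + q (x i) (x j) (x k) (y l) - q (x k) (x i) (x l) (y j),
    q (x i) (x j) (x l) (y k) + q (x i) (x j) (x k) (y l),
    q (x l) (x j) (x i) (y k) + q (x k) (x i) (x l) (y j),
    q (x l) (x j) (x k) (y i) - q (x k) (x i) (x l) (y j),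
    q (x l) (x k) (y j) (y i) + q (x i) (x j) (y k) (y l)
      + q (y j) (x i) (x k) (y l) + q (y i) (x j) (x l) (y k),
    q (y j) (x k) (x l) (y i) + q (y k) (x j) (x i) (y l)
      - q (x l) (x i) (y j) (y k) - q (x k) (x j) (y i) (y l),
    q (y j) (x i) (x l) (y k) + q (y i) (x j) (x k) (y l)
      + q (y j) (x i) (x k) (y l) + q (y i) (x j) (x l) (y k),
    q (x l) (x j) (y i) (y k) + q (x k) (x i) (y j) (y l) - q (y j) (x i) (x k) (y l)
      - q (y i) (x j) (x l) (y k) - q (x l) (x i) (y j) (y k) - q (x k) (x j) (y i) (y l)]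

/-- The family of all elements of the basis. -/
def basisFamily : Label n → P K n
  | .xxxx i j k l _ _ _ _ => q (x K i) (x K j) (x K k) (x K l)
  | .one i => q (y K i) (x K i) (x K i) (y K i)
  | .two j i _ t => basisTwo K j i t
  | .three j i k _ _ t => basisThree K j i k t
  | .four j i k l _ _ _ t => basisFour K j i k l t

end Rank

end FreeMetabelianPoisson

/-!
Write `q a b c d = [a, b, c] · d`. The identity `[[a, b], c · d] = 0` and the Leibniz rule make `q`
alternate in `c, d`; since it also alternates in `a, b` and satisfies the Jacobi identity in
`a, b, c`, it has all the symmetries of an algebraic curvature tensor (`q_swap_left`,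
`q_swap_right`, `q_bianchi`, `q_pair`). Conversely these are the only relations: every curvature
tensor `R` is the value on `q` of a linear map on the free metabelian Poisson algebra
(`IsCurvature.lift`), because `R` can be completed to a graded model of such an algebra.

That the listed elements are constants is a direct computation with the symmetries
(`basisFamily_mem_constantsB4`).

For linear independence, each listed element contains a standard monomial (one indexed as in
`setB4`) that occurs in no other listed element. The function that sends each of these monomials to
its label, and all other standard monomials to zero, extends to a curvature tensor (`curvature`),
whose lift `coord` sends the element with label `m` to the basis vector at `m`.

For spanning it is enough to bound the dimension of the space of constants. The derivation `delta`
and the opposite derivation `eps` with `x i ↦ y i`, `y i ↦ 0` generate an action of `sl₂`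
(`delta_eps`) for which the weight of a monomial is the number of its factors `x` minus the number
of its factors `y`. All weights are even and constants have no component of negative weight
(`eq_zero_of_neg_weight`), which is also the reason for the last two claims. As every irreducible
representation of even highest weight meets the weight space of weight `0` in a line, the constants
lie in the image of that weight space under a linear map (`constantsB4_le`). It is spanned by the
`[x i, x j, y k] · y l` with `j < i`, `k < l` and the `[y i, x j, x k] · y l` with `j ≤ k`, `i ≤ l`,
and the number of these is exactly the number of labels (`card_zeroIndex`).
-/

namespace FreeMetabelianPoisson

/-! ### Symmetries of `[a, b, c] · d` -/

section Symmetries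

variable {K : Type*} [Field K] {n : ℕ}

theorem zero_mul' (a : P K n) : 0 * a = 0 := by
  have h := smul_mul' (0 : K) (0 : P K n) a
  rwa [zero_smul, zero_smul] at h

theorem mul_zero' (a : P K n) : a * 0 = 0 := by rw [mul_comm', zero_mul']

theorem zero_br' (a : P K n) : ⁅(0 : P K n), a⁆ = 0 := by
  have h := smul_br' (0 : K) (0 : P K n) a
  rwa [zero_smul, zero_smul] at h

theorem br_zero' (a : P K n) : ⁅a, (0 : P K n)⁆ = 0 := by
  have h := br_smul' (0 : K) a (0 : P K n)
  rwa [zero_smul, zero_smul] at h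

theorem mul_smul' (r : K) (a b : P K n) : a * (r • b) = r • (a * b) := by
  rw [mul_comm', smul_mul', mul_comm']

theorem q_self_left (a c d : P K n) : q a a c d = 0 := by
  rw [q, br_self', zero_br', zero_mul']

theorem q_swap_left (a b c d : P K n) : q b a c d = -q a b c d := by
  have h : ⁅b, a⁆ = -⁅a, b⁆ := eq_neg_of_add_eq_zero_left (br_add_br_swap b a)
  have h' : ⁅b, a⁆ = (-1 : K) • ⁅a, b⁆ := by rw [h, neg_one_smul]
  rw [q, h', smul_br', smul_mul', neg_one_smul, q]

/-- The vanishing of `⁅⁅a, b⁆, c * d⁆` makes `⁅⁅a, b⁆, c⁆ * d` alternate in `c` and `d`. -/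
theorem q_swap_right (a b c d : P K n) : q a b d c = -q a b c d := by
  have h := br_br_mul' a b c d
  rw [leibniz', mul_comm' c] at h
  exact eq_neg_of_add_eq_zero_right h

theorem q_bianchi (a b c d : P K n) : q a b c d + q b c a d + q c a b d = 0 := by
  rw [q, q, q, ← add_mul', ← add_mul', jacobi', zero_mul']

variable [CharZero K]

/-- The symmetry of an algebraic curvature tensor under the exchange of its pairs of arguments. -/
theorem q_pair (a b c d : P K n) : q c d a b = q a b c d := by
  -- A signed sum of these four identities reduces to `2 • (q c d a b - q a b c d) = 0`.
  have h₁ := q_bianchi a b c d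
  have h₂ := q_bianchi b c d a
  have h₃ := q_bianchi c d a b
  have h₄ := q_bianchi d a b c
  rw [q_swap_right b c a d, q_swap_right c d a b, q_swap_left b d c a] at h₂
  rw [q_swap_left a d c b, q_swap_right a d b c, q_swap_left c a d b, q_swap_right c a b d] at h₃
  rw [q_swap_left a d b c, q_swap_right a b c d, q_swap_right b d c a] at h₄
  have key : (2 : K) • (q c d a b - q a b c d) = 0 := by
    linear_combination (norm := module) -h₁ - h₂ + h₃ + h₄
  exact sub_eq_zero.1 ((smul_eq_zero.1 key).resolve_left two_ne_zero)

theorem q_self_right (a b c : P K n) : q a b c c = 0 := by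
  rw [← q_pair, q_self_left]

end Symmetries

/-! ### The action of `sl₂` on the span of the monomials -/

section SlTwo

variable (K : Type*) [Field K] (n : ℕ)

/-- The derivation opposite to `delta`, with `x i ↦ y i` and `y i ↦ 0`. -/
def eps : P K n →ₗ[K] P K n :=
  der (Fin.addCases (fun i : Fin n => y K i) (fun _ : Fin n => 0))

variable {K n}

theorem delta_x (i : Fin n) : delta K n (x K i) = 0 := by
  simp [delta, x, der_of, -Fin.natAdd_eq_addNat]

theorem delta_y (i : Fin n) : delta K n (y K i) = x K i := by
  simp [delta, y, der_of, -Fin.natAdd_eq_addNat]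

theorem eps_x (i : Fin n) : eps K n (x K i) = y K i := by
  simp [eps, x, der_of, -Fin.natAdd_eq_addNat]

theorem eps_y (i : Fin n) : eps K n (y K i) = 0 := by
  simp [eps, y, der_of, -Fin.natAdd_eq_addNat]

theorem der_q (f : Fin (n + n) → P K n) (a b c d : P K n) :
    der f (q a b c d) = q (der f a) b c d + q a (der f b) c d + q a b (der f c) d
      + q a b c (der f d) := by
  simp only [q, der_mul, der_br, add_br', add_mul']

theorem delta_q (a b c d : P K n) :
    delta K n (q a b c d) = q (delta K n a) b c d + q a (delta K n b) c d + q a b (delta K n c) d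
      + q a b c (delta K n d) :=
  der_q _ a b c d

theorem eps_q (a b c d : P K n) :
    eps K n (q a b c d) = q (eps K n a) b c d + q a (eps K n b) c d + q a b (eps K n c) d
      + q a b c (eps K n d) :=
  der_q _ a b c d

/-- The weight of a generator: `1` for each `x i` and `-1` for each `y i`. -/
def wt : Fin (n + n) → ℤ := Fin.addCases (fun _ => 1) (fun _ => -1)

/-- The span of the `[z a, z b, z c] · z d` of total weight `w`. -/
def weightSpace (K : Type*) [Field K] (n : ℕ) (w : ℤ) : Submodule K (P K n) :=
  Submodule.span K {p | ∃ a b c d : Fin (n + n), wt a + wt b + wt c + wt d = w ∧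
    p = q (of K a) (of K b) (of K c) (of K d)}

theorem q_mem_weightSpace {w : ℤ} {a b c d : Fin (n + n)} (h : wt a + wt b + wt c + wt d = w) :
    q (of K a) (of K b) (of K c) (of K d) ∈ weightSpace K n w :=
  Submodule.subset_span ⟨a, b, c, d, h, rfl⟩

theorem der_mem_weightSpace {f : Fin (n + n) → P K n} {t : ℤ}
    (hf : ∀ a, f a = 0 ∨ ∃ a', wt a' = wt a + t ∧ f a = of K a') {w : ℤ} {p : P K n}
    (hp : p ∈ weightSpace K n w) : der f p ∈ weightSpace K n (w + t) := by
  induction hp using Submodule.span_induction with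
  | zero => simp
  | add _ _ _ _ h₁ h₂ => rw [map_add]; exact add_mem h₁ h₂
  | smul r _ _ h => rw [map_smul]; exact Submodule.smul_mem _ r h
  | mem p hp =>
    obtain ⟨a, b, c, d, rfl, rfl⟩ := hp
    simp only [der_q, der_of]
    refine add_mem (add_mem (add_mem ?_ ?_) ?_) ?_
    · obtain h | ⟨a', h', h⟩ := hf a <;> rw [h]
      · simp [q, zero_br', zero_mul']
      · exact q_mem_weightSpace (by omega)
    · obtain h | ⟨b', h', h⟩ := hf b <;> rw [h]
      · simp [q, zero_br', br_zero', zero_mul']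
      · exact q_mem_weightSpace (by omega)
    · obtain h | ⟨c', h', h⟩ := hf c <;> rw [h]
      · simp [q, br_zero', zero_mul']
      · exact q_mem_weightSpace (by omega)
    · obtain h | ⟨d', h', h⟩ := hf d <;> rw [h]
      · simp [q, mul_zero']
      · exact q_mem_weightSpace (by omega)

theorem delta_mem_weightSpace {w : ℤ} {p : P K n} (hp : p ∈ weightSpace K n w) :
    delta K n p ∈ weightSpace K n (w + 2) :=
  der_mem_weightSpace (fun a => by
    induction a using Fin.addCases with
    | left i => exact .inl (by simp)
    | right i => exact .inr ⟨Fin.castAdd n i, by simp [wt, -Fin.natAdd_eq_addNat],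
        by simp [x, -Fin.natAdd_eq_addNat]⟩) hp

theorem eps_mem_weightSpace {w : ℤ} {p : P K n} (hp : p ∈ weightSpace K n w) :
    eps K n p ∈ weightSpace K n (w - 2) :=
  der_mem_weightSpace (t := -2) (fun a => by
    induction a using Fin.addCases with
    | left i => exact .inr ⟨Fin.natAdd n i, by simp [wt, -Fin.natAdd_eq_addNat],
        by simp [y, -Fin.natAdd_eq_addNat]⟩
    | right i => exact .inl (by simp [-Fin.natAdd_eq_addNat])) hp

theorem delta_eps_of (a : Fin (n + n)) :
    delta K n (eps K n (of K a)) = eps K n (delta K n (of K a)) + (wt a : K) • of K a := by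
  induction a using Fin.addCases with
  | left i =>
    change delta K n (eps K n (x K i)) = eps K n (delta K n (x K i)) + _ • x K i
    simp [eps_x, delta_y, delta_x, wt, -Fin.natAdd_eq_addNat]
  | right i =>
    change delta K n (eps K n (y K i)) = eps K n (delta K n (y K i)) + _ • y K i
    simp [eps_x, eps_y, delta_y, wt, -Fin.natAdd_eq_addNat]

/-- The commutator `⁅delta, eps⁆` acts on each weight space as multiplication by the weight. -/
theorem delta_eps {w : ℤ} {p : P K n} (hp : p ∈ weightSpace K n w) :
    delta K n (eps K n p) = eps K n (delta K n p) + (w : K) • p := by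
  induction hp using Submodule.span_induction with
  | zero => simp
  | add _ _ _ _ h₁ h₂ => simp only [map_add, h₁, h₂]; module
  | smul r _ _ h => simp only [map_smul, h]; module
  | mem p hp =>
    obtain ⟨a, b, c, d, rfl, rfl⟩ := hp
    simp only [delta_q, eps_q, map_add, delta_eps_of]
    simp only [q, add_br', br_add', add_mul', mul_add', smul_br', br_smul', smul_mul', mul_smul']
    push_cast
    module

theorem wt_le (a : Fin (n + n)) : |wt a| ≤ 1 := by
  induction a using Fin.addCases <;> simp [wt, -Fin.natAdd_eq_addNat]

theorem weightSpace_eq_bot {w : ℤ} (hw : 4 < |w|) : weightSpace K n w = ⊥ := by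
  refine Submodule.span_eq_bot.2 ?_
  rintro _ ⟨a, b, c, d, rfl, -⟩
  have h₁ := wt_le a
  have h₂ := wt_le b
  have h₃ := wt_le c
  have h₄ := wt_le d
  rw [abs_le] at h₁ h₂ h₃ h₄
  rw [lt_abs] at hw
  omega

variable [CharZero K]

/-- A constant of negative weight would generate a representation of `sl₂` of negative highest
weight, which cannot be finite-dimensional: `eps ^ 2` vanishes on it, as there are no weights below
`-4`. -/
theorem eq_zero_of_neg_weight {w : ℤ} (hw : w = -2 ∨ w = -4) {p : P K n}
    (hp : p ∈ weightSpace K n w) (h : delta K n p = 0) : p = 0 := by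
  have h₁ := delta_eps hp
  have he := eps_mem_weightSpace hp
  have h₂ := delta_eps he
  have hee := eps_mem_weightSpace he
  rw [h, map_zero, zero_add] at h₁
  suffices eps K n p = 0 by
    rw [this, map_zero] at h₁
    refine (smul_eq_zero.1 h₁.symm).resolve_left ?_
    rcases hw with rfl | rfl <;> norm_num
  rcases hw with rfl | rfl
  · rw [weightSpace_eq_bot (by norm_num), Submodule.mem_bot] at hee
    rw [hee, map_zero, h₁, map_smul, ← add_smul] at h₂
    exact (smul_eq_zero.1 h₂.symm).resolve_left (by norm_num)
  · rw [weightSpace_eq_bot (by norm_num), Submodule.mem_bot] at he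
    exact he

end SlTwo

/-! ### Constants and the weight space of weight zero -/

section Weights

variable {K : Type*} [Field K] {n : ℕ}

theorem wt_eq_one_or (a : Fin (n + n)) : wt a = 1 ∨ wt a = -1 := by
  induction a using Fin.addCases <;> simp [wt, -Fin.natAdd_eq_addNat]

theorem weightSpace_eq_bot_of_odd {w : ℤ} (hw : Odd w) : weightSpace K n w = ⊥ := by
  refine Submodule.span_eq_bot.2 ?_
  rintro _ ⟨a, b, c, d, rfl, -⟩
  obtain ⟨k, hk⟩ := hw
  rcases wt_eq_one_or a with h₁ | h₁ <;> rcases wt_eq_one_or b with h₂ | h₂ <;>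
    rcases wt_eq_one_or c with h₃ | h₃ <;> rcases wt_eq_one_or d with h₄ | h₄ <;> omega

variable [CharZero K]

theorem delta_injOn_spanYYYY {p : P K n} (hp : p ∈ spanYYYY K n) (h : delta K n p = 0) : p = 0 := by
  refine eq_zero_of_neg_weight (.inr rfl) (Submodule.span_le.2 ?_ hp) h
  rintro _ ⟨i, j, k, l, rfl⟩
  exact q_mem_weightSpace (by simp [wt, -Fin.natAdd_eq_addNat])

theorem delta_injOn_spanYXYY {p : P K n} (hp : p ∈ spanYXYY K n) (h : delta K n p = 0) : p = 0 := by
  refine eq_zero_of_neg_weight (.inl rfl) (Submodule.span_le.2 ?_ hp) h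
  rintro _ ⟨i, j, k, l, rfl⟩
  exact q_mem_weightSpace (by simp [wt, -Fin.natAdd_eq_addNat])

/-- An operator that recovers every homogeneous constant, up to a nonzero scalar, from its image in
weight `0` under a power of `eps`. Its three groups of terms move weight `0` to the weights `0`, `2`
and `4` by a power of `delta` and then apply the extremal projector of `sl₂` for that weight, which
fixes the constants and kills the image of `eps`. -/
def fromZero (K : Type*) [Field K] (n : ℕ) : P K n →ₗ[K] P K n :=
  let d := delta K n
  let e := eps K n
  (LinearMap.id - (2⁻¹ : K) • e ∘ₗ d + (12⁻¹ : K) • e ∘ₗ e ∘ₗ d ∘ₗ d)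
    + (d - (4⁻¹ : K) • e ∘ₗ d ∘ₗ d) + d ∘ₗ d

/-- A homogeneous constant `p` of weight `w = 0`, `2`, `4` is the image under `fromZero` of a
multiple of `eps ^ (w / 2) p`; in all other weights there are no nonzero constants. -/
theorem mem_map_fromZero {w : ℤ} {p : P K n} (hp : p ∈ weightSpace K n w)
    (h : delta K n p = 0) : p ∈ (weightSpace K n 0).map (fromZero K n) := by
  have h₁ := delta_eps hp
  have he := eps_mem_weightSpace hp
  have h₂ := delta_eps he
  have hee := eps_mem_weightSpace he
  rw [h, map_zero, zero_add] at h₁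
  rw [h₁, map_smul] at h₂
  by_cases hw : 4 < |w|
  · rw [weightSpace_eq_bot hw, Submodule.mem_bot] at hp
    rw [hp]; exact zero_mem _
  rcases Int.even_or_odd w with hev | hodd
  swap
  · rw [weightSpace_eq_bot_of_odd hodd, Submodule.mem_bot] at hp
    rw [hp]; exact zero_mem _
  obtain rfl | rfl | rfl | hw : w = 0 ∨ w = 2 ∨ w = 4 ∨ (w = -2 ∨ w = -4) := by
    obtain ⟨k, rfl⟩ := hev
    rw [not_lt, abs_le] at hw
    omega
  · exact ⟨p, hp, by simp [fromZero, h]⟩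
  · refine ⟨(2⁻¹ : K) • eps K n p, Submodule.smul_mem _ _ he, ?_⟩
    simp only [fromZero, LinearMap.add_apply, LinearMap.sub_apply, LinearMap.smul_apply,
      LinearMap.comp_apply, LinearMap.id_apply, map_smul, h₁, h, map_zero]
    match_scalars <;> norm_num
  · refine ⟨(24⁻¹ : K) • eps K n (eps K n p), Submodule.smul_mem _ _ hee, ?_⟩
    simp only [fromZero, LinearMap.add_apply, LinearMap.sub_apply, LinearMap.smul_apply,
      LinearMap.comp_apply, LinearMap.id_apply, map_smul, map_add, h₂, h₁]
    match_scalars <;> norm_num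
  · rw [eq_zero_of_neg_weight hw hp h]; exact zero_mem _

theorem constantsB4_le : constantsB4 K n ≤ (weightSpace K n 0).map (fromZero K n) := by
  rintro p ⟨hp, h : delta K n p = 0⟩
  have hle : Submodule.span K (setB4 K n) ≤ ⨆ w, weightSpace K n w := by
    refine Submodule.span_le.2 ?_
    rintro _ ⟨a, b, c, d, -, -, -, -, rfl⟩
    exact Submodule.mem_iSup_of_mem _ (q_mem_weightSpace rfl)
  obtain ⟨f, hf, rfl⟩ := (Submodule.mem_iSup_iff_exists_finsupp _ _).1 (hle hp)
  -- The images under `delta` of the homogeneous components lie in distinct eigenspaces of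
  -- `⁅delta, eps⁆`.
  have hind := (Module.End.eigenspaces_iSupIndep
    (delta K n ∘ₗ eps K n - eps K n ∘ₗ delta K n)).comp
      (f := fun w : ℤ => ((w + 2 : ℤ) : K))
      (fun a b hab => by simpa using hab)
  rw [iSupIndep_iff_finsetSum_eq_zero_imp_eq_zero] at hind
  rw [map_finsuppSum] at h
  have hzero := hind f.support (fun w => delta K n (f w)) (fun w _ => by
    have hd := delta_eps (delta_mem_weightSpace (hf w))
    simp only [Function.comp, Module.End.mem_eigenspace_iff, LinearMap.sub_apply,
      LinearMap.comp_apply]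
    rw [hd, add_sub_cancel_left]) h
  exact sum_mem fun w hw => mem_map_fromZero (hf w) (hzero w hw)

end Weights

/-! ### The listed elements are constants -/

section Constants

variable {K : Type*} [Field K] {n : ℕ}

theorem q_zero₁ (b c d : P K n) : q 0 b c d = 0 := by rw [q, zero_br', zero_br', zero_mul']

theorem q_zero₂ (a c d : P K n) : q a 0 c d = 0 := by rw [q, br_zero', zero_br', zero_mul']

theorem q_zero₃ (a b d : P K n) : q a b 0 d = 0 := by rw [q, br_zero', zero_mul']

theorem q_zero₄ (a b c : P K n) : q a b c 0 = 0 := by rw [q, mul_zero']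

/-! The monomials of the following three kinds belong to `setB4`. -/

theorem q_xxxy_mem {a b c d : Fin n} (h : b < a) (h' : b ≤ c) :
    q (x K a) (x K b) (x K c) (y K d) ∈ Submodule.span K (setB4 K n) :=
  Submodule.subset_span ⟨_, _, _, _, h, Fin.le_def.2 (by simp; omega), h',
    Fin.lt_def.2 (by simp; omega), rfl⟩

theorem q_xxyy_mem {a b c d : Fin n} (h : b < a) (h' : c < d) :
    q (x K a) (x K b) (y K c) (y K d) ∈ Submodule.span K (setB4 K n) :=
  Submodule.subset_span ⟨_, _, _, _, h, Fin.le_def.2 (by simp; omega),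
    Fin.le_def.2 (by simp; omega), (Fin.natAdd_lt_natAdd_iff n).2 h', rfl⟩

theorem q_yxxy_mem {a b c d : Fin n} (h : b ≤ c) (h' : a ≤ d) :
    q (y K a) (x K b) (x K c) (y K d) ∈ Submodule.span K (setB4 K n) :=
  Submodule.subset_span ⟨_, _, _, _, Fin.lt_def.2 (by simp; omega),
    (Fin.natAdd_le_natAdd_iff n).2 h', h, Fin.lt_def.2 (by simp; omega), rfl⟩

theorem basisTwo_mem_span {j i : Fin n} (h : j < i) (t : Fin 7) :
    basisTwo K j i t ∈ Submodule.span K (setB4 K n) := by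
  fin_cases t <;> dsimp [basisTwo]
  all_goals
    repeat' first
      | with_reducible apply add_mem
      | with_reducible apply sub_mem
      | with_reducible apply Submodule.smul_mem
  all_goals first
    | with_reducible refine q_xxxy_mem ?_ ?_ <;> order
    | with_reducible refine q_xxyy_mem ?_ ?_ <;> order
    | with_reducible refine q_yxxy_mem ?_ ?_ <;> order

theorem basisThree_mem_span {j i k : Fin n} (h : j < i) (h' : i < k) (t : Fin 15) :
    basisThree K j i k t ∈ Submodule.span K (setB4 K n) := by
  fin_cases t <;> dsimp [basisThree]
  all_goals
    repeat' first
      | with_reducible apply add_mem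
      | with_reducible apply sub_mem
  all_goals first
    | with_reducible refine q_xxxy_mem ?_ ?_ <;> order
    | with_reducible refine q_xxyy_mem ?_ ?_ <;> order
    | with_reducible refine q_yxxy_mem ?_ ?_ <;> order

theorem basisFour_mem_span {j i k l : Fin n} (h : j < i) (h' : i < k) (h'' : k < l) (t : Fin 10) :
    basisFour K j i k l t ∈ Submodule.span K (setB4 K n) := by
  fin_cases t <;> dsimp [basisFour]
  all_goals
    repeat' first
      | with_reducible apply add_mem
      | with_reducible apply sub_mem
  all_goals first
    | with_reducible refine q_xxxy_mem ?_ ?_ <;> order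
    | with_reducible refine q_xxyy_mem ?_ ?_ <;> order
    | with_reducible refine q_yxxy_mem ?_ ?_ <;> order

variable [CharZero K]

/-! The images of the basis elements under `delta` vanish by the symmetries of `q`. -/

theorem delta_basisTwo (j i : Fin n) (t : Fin 7) : delta K n (basisTwo K j i t) = 0 := by
  fin_cases t <;>
    simp [basisTwo, delta_q, delta_x, delta_y, q_zero₁, q_zero₂, q_zero₃, q_self_left,
      q_self_right]
  · linear_combination (norm := module) q_swap_right (x K i) (x K j) (x K j) (x K i)
  · linear_combination (norm := module) q_swap_left (x K j) (x K i) (x K i) (y K i)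
  · linear_combination (norm := module) q_swap_right (y K j) (x K j) (x K i) (x K j)
  · linear_combination (norm := module) q_swap_left (x K j) (x K i) (x K i) (y K j)
      - q_swap_right (x K i) (x K j) (y K j) (x K i) + q_pair (x K i) (x K j) (y K j) (x K i)
      - q_swap_right (x K i) (x K j) (y K i) (x K j) + q_pair (x K j) (x K i) (y K i) (x K j)
      + q_swap_left (x K i) (x K j) (y K i) (x K j)

theorem delta_basisThree (j i k : Fin n) (t : Fin 15) : delta K n (basisThree K j i k t) = 0 := by
  fin_cases t <;>
    simp [basisThree, delta_q, delta_x, delta_y, q_zero₁, q_zero₂, q_zero₃, q_self_left,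
      q_self_right]
  · linear_combination (norm := module) q_swap_right (x K i) (x K j) (x K i) (x K k)
  · linear_combination (norm := module) q_swap_right (x K i) (x K j) (x K i) (x K k)
      + q_pair (x K i) (x K j) (x K k) (x K i)
  · linear_combination (norm := module) q_pair (x K k) (x K j) (x K i) (x K j)
  · linear_combination (norm := module) q_swap_right (x K i) (x K j) (x K j) (x K k)
  · linear_combination (norm := module) q_swap_right (x K k) (x K j) (x K j) (x K i)
      + q_pair (x K k) (x K j) (x K i) (x K j)
  · linear_combination (norm := module) q_swap_right (x K k) (x K j) (x K k) (x K i)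
  · linear_combination (norm := module) -q_pair (x K k) (x K j) (x K k) (x K i)
  · linear_combination (norm := module) q_swap_left (x K j) (x K i) (x K i) (y K k)
      + q_swap_right (y K j) (x K i) (x K i) (x K k) - q_pair (x K k) (x K i) (y K j) (x K i)
      + q_swap_right (x K i) (x K j) (x K k) (y K i) + q_pair (x K j) (y K i) (x K k) (x K i)
      + q_swap_left (x K j) (y K i) (x K k) (x K i)
  · linear_combination (norm := module) q_pair (x K k) (x K i) (y K j) (x K i)
      - q_swap_right (x K i) (x K j) (x K k) (y K i) + q_swap_left (x K i) (x K j) (x K k) (y K i)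
      - q_pair (x K j) (y K i) (x K k) (x K i) - q_swap_left (x K j) (y K i) (x K k) (x K i)
      + q_swap_right (y K i) (x K j) (x K k) (x K i)
  · linear_combination (norm := module) q_swap_right (x K k) (x K i) (y K k) (x K j)
      - q_pair (y K k) (x K j) (x K k) (x K i) - q_swap_right (y K k) (x K j) (x K k) (x K i)
      - q_pair (x K k) (x K i) (y K j) (x K k) - q_swap_left (x K k) (x K j) (x K k) (y K i)
      + q_swap_right (x K k) (x K j) (x K k) (y K i)
  · linear_combination (norm := module) q_swap_left (x K i) (x K j) (x K k) (y K k)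
  · linear_combination (norm := module) q_swap_right (y K j) (x K j) (x K k) (x K i)
  · linear_combination (norm := module) q_swap_left (x K j) (x K i) (y K j) (x K k)
      - q_swap_right (x K j) (x K i) (x K k) (y K j) - q_pair (x K k) (x K j) (y K j) (x K i)
      + q_swap_left (x K k) (x K j) (x K j) (y K i) - q_swap_right (x K j) (x K k) (y K i) (x K j)
      - q_pair (x K j) (x K k) (y K i) (x K j)

theorem delta_basisFour (j i k l : Fin n) (t : Fin 10) : delta K n (basisFour K j i k l t) = 0 := by
  fin_cases t <;>
    simp [basisFour, delta_q, delta_x, delta_y, q_zero₁, q_zero₂, q_zero₃]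
  · linear_combination (norm := module) -q_pair (x K i) (x K j) (x K k) (x K l)
      - q_swap_left (x K i) (x K k) (x K l) (x K j) + q_bianchi (x K i) (x K k) (x K l) (x K j)
      - q_pair (x K k) (x K j) (x K l) (x K i)
  · linear_combination (norm := module) -q_bianchi (x K i) (x K j) (x K k) (x K l)
      + q_swap_left (x K j) (x K k) (x K i) (x K l) + q_swap_right (x K k) (x K i) (x K j) (x K l)
  · linear_combination (norm := module) -q_pair (x K i) (x K j) (x K k) (x K l)
      - q_swap_left (x K i) (x K k) (x K l) (x K j) + q_bianchi (x K i) (x K k) (x K l) (x K j)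
  · linear_combination (norm := module) q_swap_right (x K i) (x K j) (x K k) (x K l)
  · linear_combination (norm := module) q_swap_left (x K i) (x K k) (x K l) (x K j)
      + q_pair (x K i) (x K k) (x K l) (x K j)
  · linear_combination (norm := module) -q_pair (x K l) (x K j) (x K k) (x K i)
  · linear_combination (norm := module) q_swap_left (x K i) (x K j) (x K k) (y K l)
      + q_swap_right (x K i) (x K j) (x K l) (y K k) + q_swap_left (x K k) (x K l) (y K j) (x K i)
      + q_pair (x K k) (x K l) (y K j) (x K i) + q_pair (x K j) (y K i) (x K l) (x K k)
      + q_swap_left (x K j) (y K i) (x K l) (x K k)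
  · linear_combination (norm := module) -q_swap_left (x K i) (x K l) (x K j) (y K k)
      + q_swap_right (x K i) (x K l) (y K k) (x K j) - q_pair (y K k) (x K j) (x K i) (x K l)
      + q_pair (x K l) (x K i) (y K j) (x K k) + q_swap_left (x K j) (x K k) (x K l) (y K i)
      - q_swap_right (x K k) (x K j) (x K l) (y K i)
  · linear_combination (norm := module) q_swap_left (x K i) (x K j) (x K k) (y K l)
      + q_swap_left (x K i) (x K j) (x K l) (y K k) + q_swap_right (y K j) (x K i) (x K k) (x K l)
      + q_swap_right (y K i) (x K j) (x K k) (x K l)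
  · linear_combination (norm := module) -q_bianchi (x K i) (x K k) (x K j) (y K l)
      + q_swap_left (x K i) (x K k) (x K j) (y K l) - q_bianchi (x K j) (x K l) (x K i) (y K k)
      + q_swap_left (x K j) (x K l) (x K i) (y K k) + q_bianchi (x K i) (y K j) (x K k) (x K l)
      - q_swap_left (y K j) (x K i) (x K k) (x K l) - q_swap_left (x K i) (x K l) (y K j) (x K k)
      - q_pair (x K i) (x K l) (y K j) (x K k) - q_pair (y K i) (x K l) (x K k) (x K j)
      + q_bianchi (x K j) (y K i) (x K l) (x K k) - q_swap_left (x K j) (y K i) (x K l) (x K k)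
      - q_swap_right (y K i) (x K l) (x K k) (x K j)

theorem basisFamily_mem_constantsB4 (m : Label n) : basisFamily K m ∈ constantsB4 K n := by
  cases m with
  | xxxx i j k l h₁ h₂ h₃ h₄ =>
    refine ⟨Submodule.subset_span ⟨_, _, _, _, h₁, h₂, h₃, h₄, rfl⟩, ?_⟩
    simp [basisFamily, delta_q, delta_x, q_zero₁, q_zero₂, q_zero₃, q_zero₄]
  | one i =>
    refine ⟨q_yxxy_mem le_rfl le_rfl, ?_⟩
    simp [basisFamily, delta_q, delta_x, delta_y, q_zero₂, q_zero₃, q_self_left, q_self_right]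
  | two j i h t => exact ⟨basisTwo_mem_span h t, delta_basisTwo j i t⟩
  | three j i k h h' t => exact ⟨basisThree_mem_span h h' t, delta_basisThree j i k t⟩
  | four j i k l h h' h'' t => exact ⟨basisFour_mem_span h h' h'' t, delta_basisFour j i k l t⟩

end Constants

/-! ### Linear maps from curvature tensors -/

section Model

variable {K : Type*} [Field K] {X M : Type*} [AddCommGroup M] [Module K M]

/-- A graded model of the part of a metabelian Poisson algebra that the values of
`⁅⁅a, b⁆, c⁆ * d` in `M` depend on, over the generating space `X →₀ K`. An element of degree two or
three is recorded through its products and brackets with generators. -/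
@[ext]
structure Model (K X M : Type*) [Field K] [AddCommGroup M] [Module K M] where
  /-- the part of degree one -/
  gen : X →₀ K
  /-- the map `(c, d) ↦ ⁅u, c⁆ * d` for a bracket `u` of two generators -/
  brTwo : (X →₀ K) →ₗ[K] (X →₀ K) →ₗ[K] M
  /-- the map `(c, d) ↦ ⁅⁅u, c⁆, d⁆` for a product `u` of two generators -/
  mulTwo : (X →₀ K) →ₗ[K] (X →₀ K) →ₗ[K] M
  /-- the map `d ↦ u * d` for an iterated bracket `u` of three generators -/
  brThree : (X →₀ K) →ₗ[K] M
  /-- the map `d ↦ ⁅u, d⁆` for `u` formed from three generators by a product and a bracket -/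
  mixThree : (X →₀ K) →ₗ[K] M
  /-- the part of degree four -/
  top : M

theorem Model.ext_apply {u v : Model K X M} (h₁ : u.gen = v.gen)
    (h₂ : ∀ c d, u.brTwo c d = v.brTwo c d) (h₃ : ∀ c d, u.mulTwo c d = v.mulTwo c d)
    (h₄ : ∀ d, u.brThree d = v.brThree d) (h₅ : ∀ d, u.mixThree d = v.mixThree d)
    (h₆ : u.top = v.top) : u = v :=
  Model.ext h₁ (LinearMap.ext₂ h₂) (LinearMap.ext₂ h₃) (LinearMap.ext h₄) (LinearMap.ext h₅) h₆

/-- The element of the model represented by an expression, given the values `R a b c d` of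
`⁅⁅a, b⁆, c⁆ * d`. -/
noncomputable def evalModel (R : (X →₀ K) →ₗ[K] (X →₀ K) →ₗ[K] (X →₀ K) →ₗ[K] (X →₀ K) →ₗ[K] M) :
    PoissonExpr K X → Model K X M
  | .of z => ⟨Finsupp.single z 1, 0, 0, 0, 0, 0⟩
  | .zero => ⟨0, 0, 0, 0, 0, 0⟩
  | .add a b =>
    let u := evalModel R a
    let v := evalModel R b
    ⟨u.gen + v.gen, u.brTwo + v.brTwo, u.mulTwo + v.mulTwo, u.brThree + v.brThree,
      u.mixThree + v.mixThree, u.top + v.top⟩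
  | .smul r a =>
    let u := evalModel R a
    ⟨r • u.gen, r • u.brTwo, r • u.mulTwo, r • u.brThree, r • u.mixThree, r • u.top⟩
  | .mul a b =>
    let u := evalModel R a
    let v := evalModel R b
    ⟨0, 0, (R v.gen).compr₂ (LinearMap.applyₗ u.gen) + (R u.gen).compr₂ (LinearMap.applyₗ v.gen),
      0, u.brTwo.flip v.gen + v.brTwo.flip u.gen, u.brThree v.gen + v.brThree u.gen⟩
  | .br a b =>
    let u := evalModel R a
    let v := evalModel R b
    ⟨0, R u.gen v.gen, 0, u.brTwo v.gen - v.brTwo u.gen, u.mulTwo v.gen - v.mulTwo u.gen,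
      u.mixThree v.gen - v.mixThree u.gen⟩

/-- The symmetries of an algebraic curvature tensor. The last one follows from the others where `2`
is invertible. -/
structure IsCurvature (R : (X →₀ K) →ₗ[K] (X →₀ K) →ₗ[K] (X →₀ K) →ₗ[K] (X →₀ K) →ₗ[K] M) :
    Prop where
  swap_left (a b c d : X →₀ K) : R b a c d = -R a b c d
  swap_right (a b c d : X →₀ K) : R a b d c = -R a b c d
  bianchi (a b c d : X →₀ K) : R a b c d + R b c a d + R c a b d = 0
  pair (a b c d : X →₀ K) : R c d a b = R a b c d

variable {R : (X →₀ K) →ₗ[K] (X →₀ K) →ₗ[K] (X →₀ K) →ₗ[K] (X →₀ K) →ₗ[K] M}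

theorem evalModel_zero : evalModel R 0 = ⟨0, 0, 0, 0, 0, 0⟩ := rfl

theorem evalModel_add (a b : PoissonExpr K X) : evalModel R (a + b) =
    ⟨(evalModel R a).gen + (evalModel R b).gen, (evalModel R a).brTwo + (evalModel R b).brTwo,
      (evalModel R a).mulTwo + (evalModel R b).mulTwo,
      (evalModel R a).brThree + (evalModel R b).brThree,
      (evalModel R a).mixThree + (evalModel R b).mixThree,
      (evalModel R a).top + (evalModel R b).top⟩ := rfl

theorem evalModel_smul (r : K) (a : PoissonExpr K X) : evalModel R (r • a) =
    ⟨r • (evalModel R a).gen, r • (evalModel R a).brTwo, r • (evalModel R a).mulTwo,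
      r • (evalModel R a).brThree, r • (evalModel R a).mixThree, r • (evalModel R a).top⟩ := rfl

theorem evalModel_mul (a b : PoissonExpr K X) : evalModel R (a * b) =
    ⟨0, 0, (R (evalModel R b).gen).compr₂ (LinearMap.applyₗ (evalModel R a).gen)
        + (R (evalModel R a).gen).compr₂ (LinearMap.applyₗ (evalModel R b).gen),
      0, (evalModel R a).brTwo.flip (evalModel R b).gen
        + (evalModel R b).brTwo.flip (evalModel R a).gen,
      (evalModel R a).brThree (evalModel R b).gen
        + (evalModel R b).brThree (evalModel R a).gen⟩ := rfl

theorem evalModel_br (a b : PoissonExpr K X) : evalModel R ⁅a, b⁆ =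
    ⟨0, R (evalModel R a).gen (evalModel R b).gen, 0,
      (evalModel R a).brTwo (evalModel R b).gen - (evalModel R b).brTwo (evalModel R a).gen,
      (evalModel R a).mulTwo (evalModel R b).gen - (evalModel R b).mulTwo (evalModel R a).gen,
      (evalModel R a).mixThree (evalModel R b).gen
        - (evalModel R b).mixThree (evalModel R a).gen⟩ := rfl

theorem IsCurvature.brTwo_swap (hR : IsCurvature R) (a : PoissonExpr K X) (c d : X →₀ K) :
    (evalModel R a).brTwo d c = -(evalModel R a).brTwo c d := by
  induction a with
  | of z => simp [evalModel]
  | zero => simp [evalModel]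
  | add a b ha hb => simp [evalModel, ha, hb]; abel
  | smul r a ha => simp [evalModel, ha]
  | mul a b => simp [evalModel]
  | br a b => simp [evalModel, hR.swap_right _ _ c d]

theorem IsCurvature.reverse (hR : IsCurvature R) (a b c d : X →₀ K) : R d c b a = R a b c d := by
  rw [← hR.pair a b c d, hR.swap_left c d, hR.swap_right c d, neg_neg]

theorem IsCurvature.mulTwo_swap (hR : IsCurvature R) (a : PoissonExpr K X) (c d : X →₀ K) :
    (evalModel R a).mulTwo d c = (evalModel R a).mulTwo c d := by
  induction a with
  | of z => simp [evalModel]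
  | zero => simp [evalModel]
  | add a b ha hb => simp [evalModel, ha, hb]
  | smul r a ha => simp [evalModel, ha]
  | mul a b => simp [evalModel, hR.reverse _ c d, add_comm]
  | br a b => simp [evalModel]

/-- A map that is linear in each of four variables vanishes if it vanishes on basis vectors. -/
theorem eq_zero_of_single {T : (X →₀ K) → (X →₀ K) → (X →₀ K) → (X →₀ K) → M}
    (h₁ : ∀ b c d, IsLinearMap K fun a => T a b c d)
    (h₂ : ∀ a c d, IsLinearMap K fun b => T a b c d)
    (h₃ : ∀ a b d, IsLinearMap K fun c => T a b c d)
    (h₄ : ∀ a b c, IsLinearMap K fun d => T a b c d)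
    (h : ∀ i j k l, T (.single i 1) (.single j 1) (.single k 1) (.single l 1) = 0)
    (a b c d : X →₀ K) : T a b c d = 0 := by
  have key {f : (X →₀ K) → M} (hf : IsLinearMap K f) (h : ∀ i, f (.single i 1) = 0)
      (a : X →₀ K) : f a = 0 := by
    have : hf.mk' f = 0 := by ext i; simpa using h i
    exact LinearMap.congr_fun this a
  exact key (h₁ b c d) (fun i => key (h₂ _ c d) (fun j => key (h₃ _ _ d)
    (fun k => key (h₄ _ _ _) (fun l => h i j k l) d) c) b) a

/-- The tensor with `a, b, c, d ↦ s b c a d - s a c b d - s b d a c + s a d b c` on basis vectors.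
If `s` is symmetric in its first two and in its last two arguments, this is a curvature tensor. -/
noncomputable def curvature (s : X → X → X → X → M) :
    (X →₀ K) →ₗ[K] (X →₀ K) →ₗ[K] (X →₀ K) →ₗ[K] (X →₀ K) →ₗ[K] M :=
  Finsupp.linearCombination K fun a => Finsupp.linearCombination K fun b =>
    Finsupp.linearCombination K fun c => Finsupp.linearCombination K fun d =>
      s b c a d - s a c b d - s b d a c + s a d b c

theorem curvature_single (s : X → X → X → X → M) (a b c d : X) :
    curvature (K := K) s (.single a 1) (.single b 1) (.single c 1) (.single d 1) =
      s b c a d - s a c b d - s b d a c + s a d b c := by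
  simp [curvature]

theorem isCurvature_curvature {s : X → X → X → X → M} (h₁ : ∀ a b c d, s b a c d = s a b c d)
    (h₂ : ∀ a b c d, s a b d c = s a b c d) : IsCurvature (curvature (K := K) s) where
  swap_left a b c d := by
    refine eq_neg_of_add_eq_zero_left (eq_zero_of_single
      (T := fun a b c d => curvature s b a c d + curvature s a b c d) ?_ ?_ ?_ ?_ ?_ a b c d)
    any_goals intros; constructor <;> intros <;> simp <;> module
    intro a b c d
    simp only [curvature_single]
    abel
  swap_right a b c d := by
    refine eq_neg_of_add_eq_zero_left (eq_zero_of_single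
      (T := fun a b c d => curvature s a b d c + curvature s a b c d) ?_ ?_ ?_ ?_ ?_ a b c d)
    any_goals intros; constructor <;> intros <;> simp <;> module
    intro a b c d
    simp only [curvature_single]
    abel
  bianchi := by
    refine eq_zero_of_single ?_ ?_ ?_ ?_ ?_
    any_goals intros; constructor <;> intros <;> simp <;> module
    intro a b c d
    simp only [curvature_single, h₁ a b, h₁ b c, h₁ a c, h₂ _ _ a b, h₂ _ _ b c, h₂ _ _ a c]
    abel
  pair a b c d := by
    refine sub_eq_zero.1 (eq_zero_of_single
      (T := fun a b c d => curvature s c d a b - curvature s a b c d) ?_ ?_ ?_ ?_ ?_ a b c d)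
    any_goals intros; constructor <;> intros <;> simp <;> module
    intro a b c d
    simp only [curvature_single, h₁ a d, h₁ b c, h₁ a c, h₁ b d, h₂ _ _ b c, h₂ _ _ a d, h₂ _ _ b d,
      h₂ _ _ a c]
    abel

variable [CharZero K]

theorem IsCurvature.self_left (hR : IsCurvature R) (a c d : X →₀ K) : R a a c d = 0 := by
  have h : (2 : K) • R a a c d = 0 := by
    linear_combination (norm := module) hR.swap_left a a c d
  exact (smul_eq_zero.1 h).resolve_left two_ne_zero

/-- The model satisfies the laws of a metabelian Poisson algebra. The symmetries of `R` enter only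
in the Jacobi identity, the Leibniz rule and the vanishing of `⁅a, a⁆`. -/
theorem IsCurvature.evalModel_rel (hR : IsCurvature R) {a b : PoissonExpr K X}
    (h : PoissonExpr.Rel K X a b) : evalModel R a = evalModel R b := by
  induction h with
  | add_left a b c h ih => simp only [evalModel_add, ih]
  | add_right a b c h ih => simp only [evalModel_add, ih]
  | smul_congr r a b h ih => simp only [evalModel_smul, ih]
  | mul_left a b c h ih => simp only [evalModel_mul, ih]
  | mul_right a b c h ih => simp only [evalModel_mul, ih]
  | br_left a b c h ih => simp only [evalModel_br, ih]
  | br_right a b c h ih => simp only [evalModel_br, ih]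
  | jacobi a b c =>
    simp only [evalModel_br, evalModel_add, evalModel_zero]
    refine Model.ext_apply ?_ ?_ ?_ ?_ ?_ ?_ <;> intros <;> simp
    · exact hR.bianchi _ _ _ _
    · rw [hR.mulTwo_swap b, hR.mulTwo_swap c, hR.mulTwo_swap a]
      abel
  | leibniz a b c =>
    simp only [evalModel_br, evalModel_add, evalModel_mul]
    refine Model.ext_apply ?_ ?_ ?_ ?_ ?_ ?_ <;> intros <;> simp
    · rw [hR.swap_left (evalModel R a).gen, hR.swap_left (evalModel R a).gen, neg_neg, neg_neg]
    · rw [hR.brTwo_swap a]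
      abel
  | br_self a =>
    simp only [evalModel_br, evalModel_zero]
    refine Model.ext_apply ?_ ?_ ?_ ?_ ?_ ?_ <;> intros <;> simp
    · exact hR.self_left _ _ _
  | _ =>
    simp only [evalModel_add, evalModel_smul, evalModel_mul, evalModel_br, evalModel_zero]
    refine Model.ext_apply ?_ ?_ ?_ ?_ ?_ ?_ <;> intros <;> simp <;> try module

/-- The linear map on the free metabelian Poisson algebra with `⁅⁅a, b⁆, c⁆ * d ↦ R a b c d` on
generators. -/
noncomputable def IsCurvature.lift (hR : IsCurvature R) : FreeMetabelianPoisson K X →ₗ[K] M where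
  toFun := Quot.lift (fun a => (evalModel R a).top) fun _ _ h =>
    congrArg Model.top (hR.evalModel_rel h)
  map_add' a b := Quot.induction_on₂ a b fun _ _ => rfl
  map_smul' _ a := Quot.inductionOn a fun _ => rfl

theorem IsCurvature.lift_of (hR : IsCurvature R) (a b c d : X) :
    hR.lift (⁅⁅of K a, of K b⁆, of K c⁆ * of K d) =
      R (.single a 1) (.single b 1) (.single c 1) (.single d 1) := by
  change (evalModel R (⁅⁅(.of a : PoissonExpr K X), (.of b : PoissonExpr K X)⁆,
    (.of c : PoissonExpr K X)⁆ * (.of d : PoissonExpr K X))).top = _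
  simp only [evalModel_mul, evalModel_br]
  simp [evalModel]

end Model

/-! ### Coordinates and linear independence -/

section Coordinates

open Finsupp

variable (K : Type*) [Field K] {n : ℕ}

/-- The label of the standard monomial `[x a, x b, x c] · x d`. This and the following definitions
take the arguments in the order of the rows `b ≤ c` and `a ≤ d` of the standard tableau with columns
`b < a` and `c < d`; the value is zero if the monomial is not standard. -/
noncomputable def coordXXXX (b c a d : Fin n) : Label n →₀ K :=
  if h : b < a ∧ a ≤ d ∧ b ≤ c ∧ c < d then
    single (.xxxx a b c d h.1 h.2.1 h.2.2.1 h.2.2.2) 1 else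
  0

/-- For `[x a, x b, x c] · y d`, the label of the only basis element that contains this monomial, if
it is one of the chosen ones, with the sign of its coefficient there; zero otherwise. -/
noncomputable def coordXXXY (b c a d : Fin n) : Label n →₀ K :=
  if h : b < a ∧ c = b ∧ d = b then single (.two b a h.1 0) 1 else
  if h : b < a ∧ c = a ∧ d = a then single (.two b a h.1 1) 1 else
  if h : b < a ∧ c = b ∧ d = a then single (.two b a h.1 2) 1 else
  if h : b < a ∧ a < c ∧ d = c then single (.three b a c h.1 h.2.1 0) 1 else
  if h : b < c ∧ c < a ∧ d = c then single (.three b c a h.1 h.2.1 1) 1 else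
  if h : b < a ∧ a < c ∧ d = a then single (.three b a c h.1 h.2.1 2) 1 else
  if h : d < b ∧ b < a ∧ c = b then single (.three d b a h.1 h.2.1 3) 1 else
  if h : b < c ∧ c < a ∧ d = b then single (.three b c a h.1 h.2.1 4) (-1) else
  if h : b < a ∧ a < d ∧ c = b then single (.three b a d h.1 h.2.1 5) 1 else
  if h : b < d ∧ d < a ∧ c = b then single (.three b d a h.1 h.2.1 6) 1 else
  if h : b < c ∧ c < a ∧ d = a then single (.three b c a h.1 h.2.1 7) 1 else
  if h : d < b ∧ b < a ∧ c = a then single (.three d b a h.1 h.2.1 8) (-1) else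
  if h : b < d ∧ d < a ∧ a < c then single (.four b d a c h.1 h.2.1 h.2.2 0) 1 else
  if h : b < c ∧ c < a ∧ a < d then single (.four b c a d h.1 h.2.1 h.2.2 1) 1 else
  if h : d < b ∧ b < c ∧ c < a then single (.four d b c a h.1 h.2.1 h.2.2 2) 1 else
  if h : b < a ∧ a < d ∧ d < c then single (.four b a d c h.1 h.2.1 h.2.2 3) 1 else
  if h : b < c ∧ c < d ∧ d < a then single (.four b c d a h.1 h.2.1 h.2.2 4) 1 else
  if h : b < d ∧ d < c ∧ c < a then single (.four b d c a h.1 h.2.1 h.2.2 5) 1 else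
  0

/-- The analogue of `coordXXXY` for `[x a, x b, y c] · y d`. -/
noncomputable def coordXXYY (b c a d : Fin n) : Label n →₀ K :=
  if h : b < c ∧ c < a ∧ d = a then single (.three b c a h.1 h.2.1 11) 1 else
  if h : b < d ∧ d < a ∧ c = b then single (.three b d a h.1 h.2.1 14) 1 else
  if h : c < d ∧ d < b ∧ b < a then single (.four c d b a h.1 h.2.1 h.2.2 6) 1 else
  if h : b < c ∧ c < d ∧ d < a then single (.four b c d a h.1 h.2.1 h.2.2 9) 1 else
  0

/-- The analogue of `coordXXXY` for `[y a, x b, x c] · y d`. -/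
noncomputable def coordYXXY (b c a d : Fin n) : Label n →₀ K :=
  if b = a ∧ c = a ∧ d = a then single (.one a) 1 else
  if h : b < c ∧ a = b ∧ d = c then single (.two b c h.1 3) 1 else
  if h : a < b ∧ c = b ∧ d = b then single (.two a b h.1 4) 1 else
  if h : a < d ∧ b = a ∧ c = a then single (.two a d h.1 5) 1 else
  if h : a < b ∧ c = b ∧ d = a then single (.two a b h.1 6) 1 else
  if h : b < a ∧ a < c ∧ d = a then single (.three b a c h.1 h.2.1 9) 1 else
  if h : a < b ∧ b < c ∧ d = b then single (.three a b c h.1 h.2.1 10) 1 else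
  if h : a < b ∧ b < c ∧ d = c then single (.three a b c h.1 h.2.1 12) 1 else
  if h : a < d ∧ d < c ∧ b = a then single (.three a d c h.1 h.2.1 13) 1 else
  if h : a < d ∧ d < b ∧ b < c then single (.four a d b c h.1 h.2.1 h.2.2 7) 1 else
  if h : a < b ∧ b < d ∧ d < c then single (.four a b d c h.1 h.2.1 h.2.2 8) 1 else
  0

/-- The label of the standard monomial with rows `{b, c}` and `{a, d}` of generators, where `.inl`
stands for `x` and `.inr` for `y`. A row that consists of one `x` and one `y` is sorted by its type,
any other row by `min` and `max`. -/
noncomputable def symbol : Fin n ⊕ Fin n → Fin n ⊕ Fin n → Fin n ⊕ Fin n → Fin n ⊕ Fin n →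
    Label n →₀ K
  | .inl b, .inl c, .inl a, .inl d => coordXXXX K (min b c) (max b c) (min a d) (max a d)
  | .inl b, .inl c, .inl a, .inr d => coordXXXY K (min b c) (max b c) a d
  | .inl b, .inl c, .inr d, .inl a => coordXXXY K (min b c) (max b c) a d
  | .inl b, .inr c, .inl a, .inr d => coordXXYY K b c a d
  | .inr c, .inl b, .inl a, .inr d => coordXXYY K b c a d
  | .inl b, .inr c, .inr d, .inl a => coordXXYY K b c a d
  | .inr c, .inl b, .inr d, .inl a => coordXXYY K b c a d
  | .inl b, .inl c, .inr a, .inr d => coordYXXY K (min b c) (max b c) (min a d) (max a d)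
  | _, _, _, _ => 0

theorem symbol_swap_left (a b c d : Fin n ⊕ Fin n) : symbol K b a c d = symbol K a b c d := by
  rcases a with a | a <;> rcases b with b | b <;> rcases c with c | c <;> rcases d with d | d <;>
    simp [symbol, min_comm, max_comm]

theorem symbol_swap_right (a b c d : Fin n ⊕ Fin n) : symbol K a b d c = symbol K a b c d := by
  rcases a with a | a <;> rcases b with b | b <;> rcases c with c | c <;> rcases d with d | d <;>
    simp [symbol, min_comm, max_comm]

variable [CharZero K]

/-- The coordinates with respect to the basis, as a linear map on the whole algebra. On a standard
monomial only the first of the four terms of `curvature` is nonzero, since the other three rearrange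
it into rows that do not form a standard tableau. -/
noncomputable def coord : P K n →ₗ[K] Label n →₀ K :=
  (isCurvature_curvature (s := fun a b c d : Fin (n + n) => symbol K (finSumFinEquiv.symm a)
    (finSumFinEquiv.symm b) (finSumFinEquiv.symm c) (finSumFinEquiv.symm d))
    (fun _ _ _ _ => symbol_swap_left K _ _ _ _) (fun _ _ _ _ => symbol_swap_right K _ _ _ _)).lift

theorem coord_q (a b c d : Fin n ⊕ Fin n) :
    coord K (q (of K (finSumFinEquiv a)) (of K (finSumFinEquiv b)) (of K (finSumFinEquiv c))
      (of K (finSumFinEquiv d))) =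
    symbol K b c a d - symbol K a c b d - symbol K b d a c + symbol K a d b c := by
  rw [q, coord, IsCurvature.lift_of, curvature_single]
  simp only [Equiv.symm_apply_apply]

variable {K}

theorem coord_xxxx (a b c d : Fin n) : coord K (q (x K a) (x K b) (x K c) (x K d)) =
    coordXXXX K (min b c) (max b c) (min a d) (max a d)
      - coordXXXX K (min a c) (max a c) (min b d) (max b d)
      - coordXXXX K (min b d) (max b d) (min a c) (max a c)
      + coordXXXX K (min a d) (max a d) (min b c) (max b c) :=
  coord_q K (.inl a) (.inl b) (.inl c) (.inl d)

theorem coord_xxxy (a b c d : Fin n) : coord K (q (x K a) (x K b) (x K c) (y K d)) =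
    coordXXXY K (min b c) (max b c) a d - coordXXXY K (min a c) (max a c) b d :=
  (coord_q K (.inl a) (.inl b) (.inl c) (.inr d)).trans (by simp [symbol])

theorem coord_xxyy (a b c d : Fin n) : coord K (q (x K a) (x K b) (y K c) (y K d)) =
    coordXXYY K b c a d - coordXXYY K a c b d - coordXXYY K b d a c + coordXXYY K a d b c :=
  coord_q K (.inl a) (.inl b) (.inr c) (.inr d)

theorem coord_yxxy (a b c d : Fin n) : coord K (q (y K a) (x K b) (x K c) (y K d)) =
    coordYXXY K (min b c) (max b c) (min a d) (max a d) - coordXXYY K c a b d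
      - coordXXYY K b d c a :=
  (coord_q K (.inr a) (.inl b) (.inl c) (.inr d)).trans (by simp [symbol])

/-- The facts by which `simp` evaluates `coordXXXY`, `coordXXYY` and `coordYXXY` on sorted
indices. -/
theorem lt_facts {a b : Fin n} (h : a < b) : a < b ∧ a ≤ b ∧ a ≠ b ∧ b ≠ a ∧ ¬b < a ∧ ¬b ≤ a ∧
    min a b = a ∧ min b a = a ∧ max a b = b ∧ max b a = b :=
  ⟨h, h.le, h.ne, h.ne', h.not_gt, h.not_ge, min_eq_left h.le, min_eq_right h.le,
    max_eq_right h.le, max_eq_left h.le⟩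

theorem coord_basisTwo {j i : Fin n} (h : j < i) (t : Fin 7) :
    coord K (basisTwo K j i t) = single (.two j i h t) 1 := by
  fin_cases t <;>
    simp [basisTwo, coord_xxxy, coord_xxyy, coord_yxxy, coordXXXY, coordXXYY, coordYXXY, lt_facts h]

theorem coord_basisThree {j i k : Fin n} (h : j < i) (h' : i < k) (t : Fin 15) :
    coord K (basisThree K j i k t) = single (.three j i k h h' t) 1 := by
  fin_cases t <;>
    simp [basisThree, coord_xxxy, coord_xxyy, coord_yxxy, coordXXXY, coordXXYY, coordYXXY,
      lt_facts h, lt_facts h', lt_facts (h.trans h')]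

theorem coord_basisFour {j i k l : Fin n} (h : j < i) (h' : i < k) (h'' : k < l) (t : Fin 10) :
    coord K (basisFour K j i k l t) = single (.four j i k l h h' h'' t) 1 := by
  fin_cases t <;>
    simp [basisFour, coord_xxxy, coord_xxyy, coord_yxxy, coordXXXY, coordXXYY, coordYXXY,
      lt_facts h, lt_facts h', lt_facts h'', lt_facts (h.trans h'), lt_facts (h'.trans h''),
      lt_facts (h.trans (h'.trans h''))]

theorem coord_basisFamily (m : Label n) : coord K (basisFamily K m) = single m 1 := by
  cases m with
  | xxxx i j k l h₁ h₂ h₃ h₄ =>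
    have h₅ : ¬i < j := by order
    have h₆ : ¬k < j := by order
    have h₇ : ¬l < k := by order
    simp [basisFamily, coord_xxxx, coordXXXX, *]
  | one i => simp [basisFamily, coord_yxxy, coordYXXY, coordXXYY]
  | two j i h t => exact coord_basisTwo h t
  | three j i k h h' t => exact coord_basisThree h h' t
  | four j i k l h h' h'' t => exact coord_basisFour h h' h'' t

theorem linearIndependent_basisFamily : LinearIndependent K (basisFamily K (n := n)) := by
  refine LinearIndependent.of_comp (coord K) ?_
  have h : coord K ∘ basisFamily K (n := n) = fun m => single m 1 := funext coord_basisFamily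
  rw [h]
  exact (Finsupp.basisSingleOne (R := K) (ι := Label n)).linearIndependent

end Coordinates

/-! ### Dimension count -/

section Count

/-- Indices of a spanning set of the weight space of weight `0`: a pair `j < i` and a pair `k < l`
for `[x i, x j, y k] · y l`, or a pair `j ≤ k` and a pair `i ≤ l` for `[y i, x j, x k] · y l`. -/
abbrev ZeroIndex (n : ℕ) : Type :=
  ({p : Fin n × Fin n // p.1 < p.2} × {p : Fin n × Fin n // p.1 < p.2}) ⊕
    ({p : Fin n × Fin n // p.1 ≤ p.2} × {p : Fin n × Fin n // p.1 ≤ p.2})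

variable (K : Type*) [Field K] {n : ℕ}

/-- The elements `[x i, x j, y k] · y l` and `[y i, x j, x k] · y l` of a `ZeroIndex`. -/
def zeroFamily : ZeroIndex n → P K n
  | .inl (p, r) => q (x K p.1.2) (x K p.1.1) (y K r.1.1) (y K r.1.2)
  | .inr (p, r) => q (y K r.1.1) (x K p.1.1) (x K p.1.2) (y K r.1.2)

variable {K}

theorem q_xxyy_mem_zero [CharZero K] (a b c d : Fin n) :
    q (x K a) (x K b) (y K c) (y K d) ∈ Submodule.span K (Set.range (zeroFamily K (n := n))) := by
  have key {a b c d : Fin n} (h : b < a) (h' : c < d) : q (x K a) (x K b) (y K c) (y K d) ∈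
      Submodule.span K (Set.range (zeroFamily K (n := n))) :=
    Submodule.subset_span ⟨.inl (⟨(b, a), h⟩, ⟨(c, d), h'⟩), rfl⟩
  rcases lt_trichotomy a b with h | rfl | h
  · rw [q_swap_left]
    refine neg_mem ?_
    rcases lt_trichotomy c d with h' | rfl | h'
    · exact key h h'
    · rw [q_self_right]; exact zero_mem _
    · rw [q_swap_right]; exact neg_mem (key h h')
  · rw [q_self_left]; exact zero_mem _
  · rcases lt_trichotomy c d with h' | rfl | h'
    · exact key h h'
    · rw [q_self_right]; exact zero_mem _
    · rw [q_swap_right]; exact neg_mem (key h h')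

theorem q_yxxy_mem_zero [CharZero K] (a b c d : Fin n) :
    q (y K a) (x K b) (x K c) (y K d) ∈ Submodule.span K (Set.range (zeroFamily K (n := n))) := by
  have key {a b c d : Fin n} (h : b ≤ c) (h' : a ≤ d) : q (y K a) (x K b) (x K c) (y K d) ∈
      Submodule.span K (Set.range (zeroFamily K (n := n))) :=
    Submodule.subset_span ⟨.inr (⟨(b, c), h⟩, ⟨(a, d), h'⟩), rfl⟩
  have swap (a b c d : Fin n) : q (y K a) (x K b) (x K c) (y K d) =
      q (y K a) (x K c) (x K b) (y K d) - q (x K b) (x K c) (y K a) (y K d) := by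
    linear_combination (norm := module) q_bianchi (y K a) (x K b) (x K c) (y K d)
      - q_swap_left (y K a) (x K c) (x K b) (y K d)
  have reverse (a b c d : Fin n) : q (y K a) (x K b) (x K c) (y K d) =
      q (y K d) (x K c) (x K b) (y K a) := by
    rw [← q_pair, q_swap_left, q_swap_right, neg_neg]
  rcases le_total b c with h | h <;> rcases le_total a d with h' | h'
  · exact key h h'
  · rw [reverse, swap]
    exact sub_mem (key h h') (q_xxyy_mem_zero _ _ _ _)
  · rw [swap]
    exact sub_mem (key h h') (q_xxyy_mem_zero _ _ _ _)
  · rw [reverse]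
    exact key h h'

/-- Up to the symmetries of `q`, a monomial with two factors `x` and two factors `y` is of the form
`[x a, x b, y c] · y d` or `[y a, x b, x c] · y d`. -/
theorem weightSpace_zero_le [CharZero K] :
    weightSpace K n 0 ≤ Submodule.span K (Set.range (zeroFamily K (n := n))) := by
  have hx (i : Fin n) : wt (Fin.castAdd n i) = 1 := by simp [wt]
  have hy (i : Fin n) : wt (Fin.natAdd n i) = -1 := by simp [wt, -Fin.natAdd_eq_addNat]
  have hox (i : Fin n) : of K (Fin.castAdd n i) = x K i := rfl
  have hoy (i : Fin n) : of K (Fin.natAdd n i) = y K i := rfl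
  refine Submodule.span_le.2 ?_
  rintro _ ⟨a, b, c, d, h, rfl⟩
  induction a using Fin.addCases <;> induction b using Fin.addCases <;>
    induction c using Fin.addCases <;> induction d using Fin.addCases <;>
    simp only [hx, hy] at h <;> norm_num at h <;> simp only [hox, hoy]
  · exact q_xxyy_mem_zero _ _ _ _
  · rw [q_swap_left]
    exact neg_mem (q_yxxy_mem_zero _ _ _ _)
  · rw [q_swap_left, q_swap_right, neg_neg]
    exact q_yxxy_mem_zero _ _ _ _
  · exact q_yxxy_mem_zero _ _ _ _
  · rw [q_swap_right]
    exact neg_mem (q_yxxy_mem_zero _ _ _ _)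
  · rw [← q_pair]
    exact q_xxyy_mem_zero _ _ _ _

/-- The labels, sorted by the kind of basis element. The largest index of a tuple is listed first,
so that iterated sums over tuples run over initial segments. -/
def labelEquiv (n : ℕ) : Label n ≃
    ((Σ p : {p : Fin n × Fin n // p.2 < p.1}, Finset.Ioc p.1.2 p.1.1 × Finset.Ico p.1.2 p.1.1) ⊕
      Fin n) ⊕ ({p : Fin n × Fin n // p.2 < p.1} × Fin 7 ⊕
    {p : Fin n × Fin n × Fin n // p.2.1 < p.1 ∧ p.2.2 < p.2.1} × Fin 15 ⊕
    {p : Fin n × Fin n × Fin n × Fin n // p.2.1 < p.1 ∧ p.2.2.1 < p.2.1 ∧ p.2.2.2 < p.2.2.1} ×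
      Fin 10) where
  toFun
    | .xxxx i j k l h₁ h₂ h₃ h₄ => .inl (.inl ⟨⟨(l, j), h₃.trans_lt h₄⟩,
        ⟨i, Finset.mem_Ioc.2 ⟨h₁, h₂⟩⟩, ⟨k, Finset.mem_Ico.2 ⟨h₃, h₄⟩⟩⟩)
    | .one i => .inl (.inr i)
    | .two j i h t => .inr (.inl (⟨(i, j), h⟩, t))
    | .three j i k h h' t => .inr (.inr (.inl (⟨(k, i, j), h', h⟩, t)))
    | .four j i k l h h' h'' t => .inr (.inr (.inr (⟨(l, k, i, j), h'', h', h⟩, t)))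
  invFun
    | .inl (.inl ⟨p, i, k⟩) => .xxxx i p.1.2 k p.1.1 (Finset.mem_Ioc.1 i.2).1
        (Finset.mem_Ioc.1 i.2).2 (Finset.mem_Ico.1 k.2).1 (Finset.mem_Ico.1 k.2).2
    | .inl (.inr i) => .one i
    | .inr (.inl (p, t)) => .two p.1.2 p.1.1 p.2 t
    | .inr (.inr (.inl (p, t))) => .three p.1.2.2 p.1.2.1 p.1.1 p.2.2 p.2.1 t
    | .inr (.inr (.inr (p, t))) =>
      .four p.1.2.2.2 p.1.2.2.1 p.1.2.1 p.1.1 p.2.2.2 p.2.2.1 p.2.1 t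
  left_inv m := by cases m <;> rfl
  right_inv p := by rcases p with (p | i) | p | p | p <;> rfl

instance (n : ℕ) : Fintype (Label n) := Fintype.ofEquiv _ (labelEquiv n).symm

theorem sum_ite_lt {n : ℕ} (b : Fin n) (f : ℕ → ℕ) :
    ∑ a : Fin n, (if a < b then f a else 0) = ∑ m ∈ Finset.range b, f m := by
  rw [← Finset.sum_filter, Finset.filter_gt_eq_Iio, ← Nat.Iio_eq_range, ← Fin.map_valEmbedding_Iio,
    Finset.sum_map]
  rfl

theorem card_lt (n : ℕ) : Fintype.card {p : Fin n × Fin n // p.2 < p.1} =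
    ∑ b ∈ Finset.range n, b := by
  rw [Fintype.card_subtype, Finset.card_filter, Fintype.sum_prod_type]
  simp only [sum_ite_lt _ fun _ => 1]
  simp [Fin.sum_univ_eq_sum_range (fun b => b)]

theorem card_lt_lt (n : ℕ) :
    Fintype.card {p : Fin n × Fin n × Fin n // p.2.1 < p.1 ∧ p.2.2 < p.2.1} =
      ∑ c ∈ Finset.range n, ∑ b ∈ Finset.range c, b := by
  rw [Fintype.card_subtype, Finset.card_filter]
  simp only [Fintype.sum_prod_type, ite_and, Finset.sum_ite_irrel, Finset.sum_const_zero,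
    sum_ite_lt _ fun _ => 1, Finset.sum_const, Finset.card_range, smul_eq_mul, mul_one,
    sum_ite_lt _ fun b => b]
  exact Fin.sum_univ_eq_sum_range (fun c => ∑ b ∈ Finset.range c, b) n

theorem card_lt_lt_lt (n : ℕ) : Fintype.card {p : Fin n × Fin n × Fin n × Fin n //
      p.2.1 < p.1 ∧ p.2.2.1 < p.2.1 ∧ p.2.2.2 < p.2.2.1} =
    ∑ d ∈ Finset.range n, ∑ c ∈ Finset.range d, ∑ b ∈ Finset.range c, b := by
  rw [Fintype.card_subtype, Finset.card_filter]
  simp only [Fintype.sum_prod_type, ite_and, Finset.sum_ite_irrel, Finset.sum_const_zero,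
    sum_ite_lt _ fun _ => 1, Finset.sum_const, Finset.card_range, smul_eq_mul, mul_one,
    sum_ite_lt _ fun b => b, sum_ite_lt _ fun c => ∑ b ∈ Finset.range c, b]
  exact Fin.sum_univ_eq_sum_range (fun d => ∑ c ∈ Finset.range d, ∑ b ∈ Finset.range c, b) n

theorem card_le_eq (n : ℕ) : Fintype.card {p : Fin n × Fin n // p.1 ≤ p.2} =
    ∑ b ∈ Finset.range n, (b + 1) := by
  rw [Fintype.card_subtype, Finset.card_filter, Fintype.sum_prod_type_right]
  simp only [← Finset.card_filter, Finset.filter_ge_eq_Iic, Fin.card_Iic]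
  exact Fin.sum_univ_eq_sum_range (fun b => b + 1) n

theorem card_xxxx (n : ℕ) : Fintype.card (Σ p : {p : Fin n × Fin n // p.2 < p.1},
      Finset.Ioc p.1.2 p.1.1 × Finset.Ico p.1.2 p.1.1) =
    ∑ l ∈ Finset.range n, ∑ j ∈ Finset.range l, (l - j) ^ 2 := by
  simp only [Fintype.card_sigma, Fintype.card_prod, Fintype.card_coe, Fin.card_Ioc, Fin.card_Ico,
    ← sq]
  rw [← Finset.sum_subtype (Finset.univ.filter fun p : Fin n × Fin n => p.2 < p.1) (by simp)
    fun p => ((p.1 : ℕ) - p.2) ^ 2, Finset.sum_filter, Fintype.sum_prod_type]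
  simp only [fun l : Fin n => sum_ite_lt l fun j => ((l : ℕ) - j) ^ 2]
  exact Fin.sum_univ_eq_sum_range (fun l => ∑ j ∈ Finset.range l, (l - j) ^ 2) n

/-- The number of labels is the number of spanning elements of the weight space of weight `0`; both
are equal to `n ^ 2 * (n ^ 2 + 1) / 2`. -/
theorem card_zeroIndex (n : ℕ) : Fintype.card (ZeroIndex n) = Fintype.card (Label n) := by
  have h₁ (n : ℕ) : ((∑ b ∈ Finset.range n, b : ℕ) : ℚ) = n * (n - 1) / 2 := by
    induction n with
    | zero => simp
    | succ n ih => rw [Finset.sum_range_succ, Nat.cast_add, ih]; push_cast; ring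
  have h₂ (n : ℕ) : ((∑ c ∈ Finset.range n, ∑ b ∈ Finset.range c, b : ℕ) : ℚ) =
      n * (n - 1) * (n - 2) / 6 := by
    induction n with
    | zero => simp
    | succ n ih => rw [Finset.sum_range_succ, Nat.cast_add, ih, h₁]; push_cast; ring
  have h₃ (n : ℕ) :
      ((∑ d ∈ Finset.range n, ∑ c ∈ Finset.range d, ∑ b ∈ Finset.range c, b : ℕ) : ℚ) =
      n * (n - 1) * (n - 2) * (n - 3) / 24 := by
    induction n with
    | zero => simp
    | succ n ih => rw [Finset.sum_range_succ, Nat.cast_add, ih, h₂]; push_cast; ring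
  have h₄ (n : ℕ) : ((∑ b ∈ Finset.range n, (b + 1) : ℕ) : ℚ) = n * (n + 1) / 2 := by
    induction n with
    | zero => simp
    | succ n ih => rw [Finset.sum_range_succ, Nat.cast_add, ih]; push_cast; ring
  have h₅ (l : ℕ) : ((∑ j ∈ Finset.range l, (l - j) ^ 2 : ℕ) : ℚ) =
      l * (l + 1) * (2 * l + 1) / 6 := by
    rw [← Finset.sum_range_reflect]
    have : ∀ j ∈ Finset.range l, (l - (l - 1 - j)) ^ 2 = (j + 1) ^ 2 := fun j hj => by
      rw [Finset.mem_range] at hj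
      congr 1
      omega
    rw [Finset.sum_congr rfl this]
    clear this
    induction l with
    | zero => simp
    | succ n ih => rw [Finset.sum_range_succ, Nat.cast_add, ih]; push_cast; ring
  have h₆ (n : ℕ) : ((∑ l ∈ Finset.range n, ∑ j ∈ Finset.range l, (l - j) ^ 2 : ℕ) : ℚ) =
      n ^ 2 * (n ^ 2 - 1) / 12 := by
    induction n with
    | zero => simp
    | succ n ih => rw [Finset.sum_range_succ, Nat.cast_add, ih, h₅]; push_cast; ring
  have hlt : Fintype.card {p : Fin n × Fin n // p.1 < p.2} =
      Fintype.card {p : Fin n × Fin n // p.2 < p.1} :=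
    Fintype.card_congr ((Equiv.prodComm _ _).subtypeEquiv fun _ => Iff.rfl)
  have hz : Fintype.card (ZeroIndex n) = (∑ b ∈ Finset.range n, b) * (∑ b ∈ Finset.range n, b)
      + (∑ b ∈ Finset.range n, (b + 1)) * (∑ b ∈ Finset.range n, (b + 1)) := by
    rw [Fintype.card_sum, Fintype.card_prod, Fintype.card_prod, hlt, card_lt, card_le_eq]
  rw [hz, Fintype.card_congr (labelEquiv n)]
  simp only [Fintype.card_sum, card_xxxx]
  simp only [Fintype.card_prod, card_lt, card_lt_lt, card_lt_lt_lt, Fintype.card_fin]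
  rw [← Nat.cast_inj (R := ℚ)]
  simp only [Nat.cast_add, Nat.cast_mul, h₁, h₂, h₃, h₄, h₆, Nat.cast_ofNat]
  ring

variable (K) in
theorem finrank_constantsB4_le [CharZero K] :
    FiniteDimensional K (constantsB4 K n) ∧
      Module.finrank K (constantsB4 K n) ≤ Fintype.card (Label n) := by
  have hle : constantsB4 K n ≤
      (Submodule.span K (Set.range (zeroFamily K (n := n)))).map (fromZero K n) :=
    constantsB4_le.trans (Submodule.map_mono weightSpace_zero_le)
  have : FiniteDimensional K (Submodule.span K (Set.range (zeroFamily K (n := n)))) :=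
    FiniteDimensional.span_of_finite K (Set.finite_range _)
  refine ⟨Submodule.finiteDimensional_of_le hle, (Submodule.finrank_mono hle).trans ?_⟩
  rw [← card_zeroIndex]
  exact (Submodule.finrank_map_le _ _).trans (finrank_range_le_card _)

theorem span_basisFamily [CharZero K] :
    Submodule.span K (Set.range (basisFamily K (n := n))) = constantsB4 K n := by
  obtain ⟨hfin, hrank⟩ := finrank_constantsB4_le K (n := n)
  refine Submodule.eq_of_le_of_finrank_le (Submodule.span_le.2 ?_) ?_
  · rintro _ ⟨m, rfl⟩
    exact basisFamily_mem_constantsB4 m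
  · rwa [finrank_span_eq_card linearIndependent_basisFamily]

end Count

end FreeMetabelianPoisson

theorem mainTheorem2 (K : Type*) [Field K] [CharZero K] (n : ℕ) :
    LinearIndependent K (FreeMetabelianPoisson.basisFamily K (n := n)) ∧
    Submodule.span K (Set.range (FreeMetabelianPoisson.basisFamily K (n := n))) =
      FreeMetabelianPoisson.constantsB4 K n ∧
    (∀ p ∈ FreeMetabelianPoisson.spanYYYY K n, FreeMetabelianPoisson.delta K n p = 0 → p = 0) ∧
    (∀ p ∈ FreeMetabelianPoisson.spanYXYY K n,
      FreeMetabelianPoisson.delta K n p = 0 → p = 0) :=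
  ⟨FreeMetabelianPoisson.linearIndependent_basisFamily, FreeMetabelianPoisson.span_basisFamily,
    fun _ hp h => FreeMetabelianPoisson.delta_injOn_spanYYYY hp h,
    fun _ hp h => FreeMetabelianPoisson.delta_injOn_spanYXYY hp h⟩
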